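/- Let $d\ge 1$ be an integer and $T>0$. For $1\le k\le d$ let $P_k(x_1,\dots,x_d)=(x_1,\dots,x_k,0,\dots,0)$ and $g_k(x)=-|P_k(x)|$ on $\mathbb R^d$, where $|\cdot|$ is the Euclidean norm. The function $g_k$ is $1$-Lipschitz and concave. For $\varepsilon\in(0,1]$, consider $$-\partial_t\varphi_t+\tfrac12|\nabla\varphi_t|^2=\tfrac{\varepsilon}{2}\Delta\varphi_t\ \text{ on }(0,T)\times\mathbb R^d,\qquad \varphi_T=g_k. \tag{1}$$ By a solution of (1) we mean a function that is continuous on $[0,T]\times\mathbb R^d$, of class $C^{1,2}$ on $(0,T)\times\mathbb R^d$, satisfies (1) pointwise, and has at most linear growth: $|\varphi_t(x)|\le C(1+|x|)$ on $[0,T]\times\mathbb R^d$ for some constant $C$. Consider also $$-\partial_t\varphi_t+\tfrac12|\nabla\varphi_t|^2=0\ \text{ on }(0,T)\times\mathbb R^d,\qquad \varphi_T=g_k, \tag{2}$$ whose solutions are understood in the viscosity sense, continuous on $[0,T]\times\mathbb R^d$ and with at most linear growth. Each of these problems has exactly one solution on $[0,T]\times\mathbb R^d$; denote by $\varphi^{k,\varepsilon}$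 the solution of (1) and by $\varphi^{k,0}$ the solution of (2). (i) For all $1\le k\le d$ and all $t\in[0,T)$, as $\varepsilon\to0^+$, $$\varphi^{k,\varepsilon}_t(0)=\varphi^{k,0}_t(0)+\frac{k-1}{2}\,\varepsilon\log\varepsilon-\frac{k-1}{2}\,\varepsilon\log(T-t)-\varepsilon\log\frac{k\sqrt{\pi}}{2^{\frac{k-1}{2}}\,\Gamma(\frac k2+1)}+o(\varepsilon).$$ (ii) The rate $\varepsilon\log\varepsilon$ cannot be improved in dimension $d\ge2$: if $r$ is a real function such that, for all sufficiently small $\varepsilon>0$, $|\varphi^{d,\varepsilon}_t(x)-\varphi^{d,0}_t(x)|\le r(\varepsilon)$ for all $(t,x)\in[0,T]\times\mathbb R^d$, then $\varepsilon\log\varepsilon=O(r(\varepsilon))$ as $\varepsilon\to0^+$. (iii) The constant cannot be below $\frac{d-1}{2}$: if $C\in\mathbb R$ is such that, for all sufficiently small $\varepsilon>0$, $|\varphi^{d,\varepsilon}_t(x)-\varphi^{d,0}_t(x)|\le -C\,\varepsilon\log\varepsilon$ for all $(t,x)\in[0,T]\times\mathbb R^d$, then $C\ge\frac{d-1}{2}$.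 Likewise, if $c,C\in\mathbb R$ are such that, for all sufficiently small $\varepsilon>0$, $\varphi^{d,\varepsilon}_t(x)-\varphi^{d,0}_t(x)\ge c\,\varepsilon\log\varepsilon-C\varepsilon$ for all $(t,x)\in[0,T]\times\mathbb R^d$, then $c\ge\frac{d-1}{2}$. -/

import Mathlib

open Set Filter Topology Asymptotics

/-- Euclidean space `ℝ^d`. -/
abbrev Rd (d : ℕ) : Type := EuclideanSpace ℝ (Fin d)

/-- The orthogonal projection `(x_1, …, x_d) ↦ (x_1, …, x_k, 0, …, 0)`. -/
noncomputable def projFirst (d k : ℕ) (x : Rd d) : Rd d :=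
  WithLp.toLp 2 (fun i : Fin d => if (i : ℕ) < k then x i else 0)

/-- The terminal datum `g_k(x) = -|P_k x|`. -/
noncomputable def negNormProj (d k : ℕ) (x : Rd d) : ℝ := -‖projFirst d k x‖

/-- At most linear growth in space, uniformly in `t ∈ [0,T]`. -/
def HasLinearGrowth (d : ℕ) (T : ℝ) (φ : ℝ → Rd d → ℝ) : Prop :=
  ∃ C : ℝ, ∀ t ∈ Icc (0 : ℝ) T, ∀ x : Rd d, |φ t x| ≤ C * (1 + ‖x‖)

/-- `φ` (as `φ t x`) is of class `C^{1,2}` on `(0,T) × ℝ^d`: `φ`, `∂_t φ`, `D_x φ`, `D_x² φ`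
exist and are jointly continuous there (continuity of `φ` itself is part of the solution notion
below). -/
structure IsC12 (d : ℕ) (T : ℝ) (φ : ℝ → Rd d → ℝ) : Prop where
  differentiableAt_time : ∀ t ∈ Ioo (0 : ℝ) T, ∀ x : Rd d, DifferentiableAt ℝ (fun s => φ s x) t
  contDiff_space : ∀ t ∈ Ioo (0 : ℝ) T, ContDiff ℝ 2 (φ t)
  continuousOn_deriv_time :
    ContinuousOn (fun p : ℝ × Rd d => deriv (fun s => φ s p.2) p.1) (Ioo 0 T ×ˢ univ)
  continuousOn_fderiv_space :
    ContinuousOn (fun p : ℝ × Rd d => fderiv ℝ (φ p.1) p.2) (Ioo 0 T ×ˢ univ)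
  continuousOn_hessian_space :
    ContinuousOn (fun p : ℝ × Rd d => iteratedFDeriv ℝ 2 (φ p.1) p.2) (Ioo 0 T ×ˢ univ)

/-- Classical solution of the viscous Hamilton-Jacobi-Bellman equation
`-∂_t φ + |∇φ|²/2 - f = (ε/2) Δφ` on `(0,T) × ℝ^d`, `φ_T = g`: continuous on `[0,T] × ℝ^d`,
`C^{1,2}` on `(0,T) × ℝ^d`, with at most linear growth. -/
structure IsViscousHJSolution (d : ℕ) (T ε : ℝ) (f g : Rd d → ℝ) (φ : ℝ → Rd d → ℝ) : Prop where
  continuousOn : ContinuousOn (fun p : ℝ × Rd d => φ p.1 p.2) (Icc 0 T ×ˢ univ)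
  linearGrowth : HasLinearGrowth d T φ
  regular : IsC12 d T φ
  equation : ∀ t ∈ Ioo (0 : ℝ) T, ∀ x : Rd d,
    -deriv (fun s => φ s x) t + 1 / 2 * ‖gradient (φ t) x‖ ^ 2 - f x
      = ε / 2 * Laplacian.laplacian (φ t) x
  terminal : ∀ x : Rd d, φ T x = g x

/-- The first-order Hamilton-Jacobi operator `-∂_t χ + |∇χ|²/2 - f` at the point `(t,x)`. -/
noncomputable def hjOperator (d : ℕ) (f : Rd d → ℝ) (χ : ℝ × Rd d → ℝ) (t : ℝ) (x : Rd d) : ℝ :=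
  -deriv (fun s => χ (s, x)) t + 1 / 2 * ‖gradient (fun y => χ (t, y)) x‖ ^ 2 - f x

/-- Continuous viscosity solution (with at most linear growth) of
`-∂_t φ + |∇φ|²/2 - f = 0` on `(0,T) × ℝ^d`, `φ_T = g`, tested with `C^1` functions. -/
structure IsViscosityHJSolution (d : ℕ) (T : ℝ) (f g : Rd d → ℝ) (φ : ℝ → Rd d → ℝ) : Prop where
  continuousOn : ContinuousOn (fun p : ℝ × Rd d => φ p.1 p.2) (Icc 0 T ×ˢ univ)
  linearGrowth : HasLinearGrowth d T φ
  subsolution : ∀ χ : ℝ × Rd d → ℝ, ContDiffOn ℝ 1 χ (Ioo 0 T ×ˢ univ) →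
    ∀ t ∈ Ioo (0 : ℝ) T, ∀ x : Rd d,
      IsLocalMax (fun p : ℝ × Rd d => φ p.1 p.2 - χ p) (t, x) → hjOperator d f χ t x ≤ 0
  supersolution : ∀ χ : ℝ × Rd d → ℝ, ContDiffOn ℝ 1 χ (Ioo 0 T ×ˢ univ) →
    ∀ t ∈ Ioo (0 : ℝ) T, ∀ x : Rd d,
      IsLocalMin (fun p : ℝ × Rd d => φ p.1 p.2 - χ p) (t, x) → 0 ≤ hjOperator d f χ t x
  terminal : ∀ x : Rd d, φ T x = g x

/-!
The terminal datum only depends on `L x = (x_1, …, x_k)`, where `L : ℝ^d → ℝ^k` satisfies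
`L L^* = 1`, and both problems have explicit solutions, `φ⁰` for the inviscid and `φ^ε` for the
viscous one:
`φ⁰_t(x) = -|L x| - (T-t)/2` and `φ^ε_t(x) = -ε log E[exp(|L x + √(ε(T-t)) Z| / ε)]`,
with `Z` a standard Gaussian vector of `ℝ^k`.

*Inviscid problem.* That `φ⁰` is a viscosity solution uses two facts about `-|L x|` only: it is
`1`-Lipschitz, and from every point it decreases at unit speed in some direction. For uniqueness,
no doubling of variables is needed: `φ⁰` is the infimum of the affine solutions
`-⟪v, L x⟫ - (T-t)/2`, `|v| = 1`, and the supremum of the smooth subsolutions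
`-√(η² + |L x|²) - (T-t)/2`, and smooth functions, corrected by a quadratic barrier, can be used as
test functions (`IsViscosityHJSolution.le_of_smooth`, `IsViscosityHJSolution.ge_of_smooth`).

*Viscous problem.* The Cole–Hopf transform `exp(-φ/ε)` turns the equation into the backward heat
equation, and linear growth into exponential growth, a class in which the maximum principle holds
with the barrier `e^{λ(T-t)} ∑ cosh(b xᵢ)`; this gives uniqueness. Both uniqueness proofs rest on
`nonpos_of_no_penalized_max`. For existence, expanding the square in the heat kernel expresses the
Gaussian average through the transform `(q,p) ↦ ∫ e^{⟪p,y⟫ - q|y|²} e^{a|y|} dy`, which is smooth on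
`q > 0`; the heat equation becomes an identity between moments.

*Expansion.* At `x = 0`, in polar coordinates, the average is
`c ∫_0^∞ r^{k-1} e^{Ar - r²/2} dr` with `A = √((T-t)/ε)`, and
this integral is asymptotic to `√(2π) A^{k-1} e^{A²/2}` (`tendsto_radial_integral`). Taking `-ε log`
gives the expansion. It yields `(φ^{d,ε}_0(0) - φ^{d,0}_0(0)) / (ε log ε) → (d-1)/2`, from which the
sharpness statements follow.
-/

/-! ### The penalized maximum principle -/

/-- **Penalized maximum principle.** If `w ≤ 0` at time `T` and at infinity `w` is dominated by
every multiple of the barrier `ρ`, and if for small `δ` the function `w - δ ρ - δ / t` has no local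
maximum in the open cylinder, then `w ≤ 0`. The term `δ / t` keeps maxima away from time `0`, where
no equation is available. -/
theorem nonpos_of_no_penalized_max {d : ℕ} {T : ℝ} (hT : 0 < T) {w ρ : ℝ × Rd d → ℝ}
    (hw : ContinuousOn w (Icc 0 T ×ˢ univ)) (hρ : Continuous ρ)
    (hρ0 : ∀ t ∈ Icc 0 T, ∀ x, 0 ≤ ρ (t, x))
    (hgrowth : ∀ δ > 0, ∃ R : ℝ, ∀ t ∈ Icc 0 T, ∀ x : Rd d, R < ‖x‖ → w (t, x) ≤ δ * ρ (t, x))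
    (hterm : ∀ x, w (T, x) ≤ 0)
    (hno : ∀ᶠ δ in 𝓝[>] (0 : ℝ), ∀ t ∈ Ioo 0 T, ∀ x,
      ¬ IsLocalMax (fun p : ℝ × Rd d => w p - δ * ρ p - δ / p.1) (t, x)) :
    ∀ t ∈ Icc 0 T, ∀ x, w (t, x) ≤ 0 := by
  have key : ∀ t ∈ Ioo 0 T, ∀ x, w (t, x) ≤ 0 := by
    intro t₁ ht₁ x₁
    by_contra! hpos
    have hsmall : ∀ᶠ δ in 𝓝[>] (0 : ℝ), δ * (ρ (t₁, x₁) + 1 / t₁) < w (t₁, x₁) := by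
      have : Tendsto (fun δ : ℝ => δ * (ρ (t₁, x₁) + 1 / t₁)) (𝓝[>] 0) (𝓝 (0 * _)) :=
        (tendsto_nhdsWithin_of_tendsto_nhds tendsto_id).mul tendsto_const_nhds
      rw [zero_mul] at this
      exact this.eventually_lt_const hpos
    obtain ⟨δ, ⟨hno, hδs⟩, hδ⟩ := ((hno.and hsmall).and self_mem_nhdsWithin).exists
    replace hδ : 0 < δ := hδ
    obtain ⟨R, hR⟩ := hgrowth δ hδ
    obtain ⟨M, hM⟩ := ((isCompact_Icc.prod (isCompact_closedBall (0 : Rd d) R)).bddAbove_image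
      (hw.mono (prod_mono (Subset.refl (Icc 0 T)) (subset_univ _))))
    set h : ℝ × Rd d → ℝ := fun p => w p - δ * ρ p - δ / p.1 with hh
    have hbig : ∀ t ∈ Ioc 0 T, ∀ x, R < ‖x‖ → h (t, x) ≤ 0 := by
      intro t ht x hx
      have := hR t ⟨ht.1.le, ht.2⟩ x hx
      have : 0 < δ / t := div_pos hδ ht.1
      simp only [hh]; linarith
    have hM' : ∀ t ∈ Icc 0 T, ∀ x : Rd d, ‖x‖ ≤ R → w (t, x) ≤ max M 1 := fun t ht x hx =>
      (hM ⟨(t, x), ⟨ht, by simpa using hx⟩, rfl⟩).trans (le_max_left _ _)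
    have hM1 : 0 < max M 1 := lt_of_lt_of_le one_pos (le_max_right _ _)
    -- Below the time `s` the penalty `δ / t` exceeds the bound of `w` on the compact cylinder.
    set s := min (δ / max M 1) T with hs
    have hs0 : 0 < s := lt_min (div_pos hδ hM1) hT
    have hlow : ∀ t ∈ Ioc 0 s, ∀ x, h (t, x) ≤ 0 := by
      intro t ht x
      have htT : t ≤ T := ht.2.trans (min_le_right _ _)
      rcases le_or_gt ‖x‖ R with hx | hx
      · have h1 := hM' t ⟨ht.1.le, htT⟩ x hx
        have h2 := hρ0 t ⟨ht.1.le, htT⟩ x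
        have h3 : max M 1 ≤ δ / t := by
          rw [le_div_iff₀ ht.1, mul_comm, ← le_div_iff₀ hM1]
          exact ht.2.trans (min_le_left _ _)
        have := mul_nonneg hδ.le h2
        simp only [hh]; linarith
      · exact hbig t ⟨ht.1, htT⟩ x hx
    have hp₁ : 0 < h (t₁, x₁) := by
      have : δ * (ρ (t₁, x₁) + 1 / t₁) = δ * ρ (t₁, x₁) + δ / t₁ := by ring
      simp only [hh]; linarith
    have hmem : (t₁, x₁) ∈ Icc s T ×ˢ Metric.closedBall (0 : Rd d) R := by
      refine ⟨⟨?_, ht₁.2.le⟩, ?_⟩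
      · by_contra! hlt
        exact absurd (hlow t₁ ⟨ht₁.1, hlt.le⟩ x₁) (not_le.2 hp₁)
      · by_contra! hlt
        refine absurd (hbig t₁ ⟨ht₁.1, ht₁.2.le⟩ x₁ ?_) (not_le.2 hp₁)
        simpa using hlt
    have hcont : ContinuousOn h (Icc s T ×ˢ Metric.closedBall (0 : Rd d) R) := by
      refine ((hw.mono (prod_mono (Icc_subset_Icc_left hs0.le) (subset_univ _))).sub
        (hρ.const_mul δ).continuousOn).sub (continuousOn_const.div continuous_fst.continuousOn ?_)
      rintro p ⟨hp, -⟩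
      exact (hs0.trans_le hp.1).ne'
    obtain ⟨⟨t₀, x₀⟩, ⟨ht₀, hx₀⟩, hmax⟩ :=
      (isCompact_Icc.prod (isCompact_closedBall (0 : Rd d) R)).exists_isMaxOn ⟨_, hmem⟩ hcont
    have hp₀ : 0 < h (t₀, x₀) := hp₁.trans_le (hmax hmem)
    have ht₀0 : 0 < t₀ := hs0.trans_le ht₀.1
    have ht₀T : t₀ < T := by
      refine lt_of_le_of_ne ht₀.2 ?_
      rintro rfl
      have h1 := hterm x₀
      have h2 := mul_nonneg hδ.le (hρ0 t₀ ⟨ht₀0.le, le_rfl⟩ x₀)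
      have h3 : 0 < δ / t₀ := div_pos hδ ht₀0
      simp only [hh] at hp₀; linarith
    refine hno t₀ ⟨ht₀0, ht₀T⟩ x₀ ?_
    filter_upwards [(isOpen_Ioo.prod isOpen_univ).mem_nhds
      (show (t₀, x₀) ∈ Ioo 0 T ×ˢ univ from ⟨⟨ht₀0, ht₀T⟩, mem_univ _⟩)]
    rintro ⟨t, x⟩ ⟨ht, -⟩
    rcases le_or_gt t s with hts | hts
    · exact (hlow t ⟨ht.1, hts⟩ x).trans hp₀.le
    rcases le_or_gt ‖x‖ R with hx | hx
    · exact hmax (show (t, x) ∈ _ from ⟨⟨hts.le, ht.2.le⟩, by simpa using hx⟩)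
    · exact (hbig t ⟨ht.1, ht.2.le⟩ x hx).trans hp₀.le
  intro t ht x
  rcases ht.2.eq_or_lt with rfl | htT
  · exact hterm x
  rcases ht.1.eq_or_lt with rfl | ht0
  · have hc : Tendsto (fun s => w (s, x)) (𝓝[>] 0) (𝓝 (w (0, x))) := by
      have := hw (0, x) ⟨⟨le_rfl, hT.le⟩, mem_univ _⟩
      refine this.tendsto.comp (tendsto_nhdsWithin_iff.2 ⟨?_, ?_⟩)
      · exact tendsto_nhdsWithin_of_tendsto_nhds
          ((continuous_id.prodMk continuous_const).tendsto' _ _ rfl)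
      · filter_upwards [Ioo_mem_nhdsGT hT] with s hs
        exact ⟨⟨hs.1.le, hs.2.le⟩, mem_univ _⟩
    refine le_of_tendsto hc ?_
    filter_upwards [Ioo_mem_nhdsGT hT] with s hs using key s hs x
  · exact key t ⟨ht0, htT⟩ x

/-- The restriction `(x_1, …, x_d) ↦ (x_1, …, x_k)`. -/
noncomputable def restrictFirst {d k : ℕ} (h : k ≤ d) : Rd d →L[ℝ] Rd k :=
  LinearMap.toContinuousLinearMap
    { toFun := fun x => WithLp.toLp 2 fun j => x (Fin.castLE h j)
      map_add' := fun x y => by ext; simp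
      map_smul' := fun c x => by ext; simp }

@[simp] theorem restrictFirst_apply {d k : ℕ} (h : k ≤ d) (x : Rd d) (j : Fin k) :
    restrictFirst h x j = x (Fin.castLE h j) := rfl

/-- A sum over the first `k` of `d` coordinates. -/
theorem sum_castLE {d k : ℕ} (h : k ≤ d) (f : Fin d → ℝ) :
    ∑ j : Fin k, f (Fin.castLE h j) = ∑ i : Fin d, if (i : ℕ) < k then f i else 0 := by
  rw [← Finset.sum_filter]
  refine Finset.sum_bij (fun j _ => Fin.castLE h j) (by simp) (by simp) ?_ (by simp)
  intro i hi
  exact ⟨⟨i, by simpa using hi⟩, by simp, rfl⟩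

theorem negNormProj_eq {d k : ℕ} (h : k ≤ d) (x : Rd d) :
    negNormProj d k x = -‖restrictFirst h x‖ := by
  rw [negNormProj, EuclideanSpace.norm_eq, EuclideanSpace.norm_eq]
  congr 2
  simp only [restrictFirst_apply]
  rw [sum_castLE h (fun i => ‖x i‖ ^ 2)]
  refine Finset.sum_congr rfl fun i _ => ?_
  by_cases hi : (i : ℕ) < k <;> simp [projFirst, hi]

theorem norm_restrictFirst_le {d k : ℕ} (h : k ≤ d) (x : Rd d) : ‖restrictFirst h x‖ ≤ ‖x‖ := by
  rw [EuclideanSpace.norm_eq, EuclideanSpace.norm_eq]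
  refine Real.sqrt_le_sqrt ?_
  simp only [restrictFirst_apply]
  rw [sum_castLE h (fun i => ‖x i‖ ^ 2)]
  refine Finset.sum_le_sum fun i _ => ?_
  split_ifs
  · exact le_rfl
  · positivity

/-- `L L^* = 1` for the restriction `L` to the first coordinates. -/
theorem restrictFirst_adjoint {d k : ℕ} (h : k ≤ d) (v : Rd k) :
    restrictFirst h ((restrictFirst h).adjoint v) = v := by
  ext j
  have h1 : restrictFirst h ((restrictFirst h).adjoint v) j =
      inner ℝ (EuclideanSpace.basisFun (Fin d) ℝ (Fin.castLE h j))
        ((restrictFirst h).adjoint v) := by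
    rw [EuclideanSpace.basisFun_apply, EuclideanSpace.inner_single_left]
    simp
  rw [h1, ContinuousLinearMap.adjoint_inner_right]
  have h2 : restrictFirst h (EuclideanSpace.basisFun (Fin d) ℝ (Fin.castLE h j)) =
      EuclideanSpace.basisFun (Fin k) ℝ j := by
    ext l
    simp [EuclideanSpace.basisFun_apply]
  rw [h2, EuclideanSpace.basisFun_apply, EuclideanSpace.inner_single_left]
  simp

theorem norm_adjoint_restrictFirst {d k : ℕ} (h : k ≤ d) (v : Rd k) :
    ‖(restrictFirst h).adjoint v‖ = ‖v‖ := by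
  have : ‖(restrictFirst h).adjoint v‖ ^ 2 = ‖v‖ ^ 2 := by
    rw [← real_inner_self_eq_norm_sq, ContinuousLinearMap.adjoint_inner_left,
      restrictFirst_adjoint, real_inner_self_eq_norm_sq]
  exact (sq_eq_sq₀ (norm_nonneg _) (norm_nonneg _)).1 this

theorem sum_inner_restrictFirst {d k : ℕ} (h : k ≤ d) (y z : Rd k) :
    ∑ i : Fin d, inner ℝ y (restrictFirst h (EuclideanSpace.basisFun (Fin d) ℝ i)) *
      inner ℝ z (restrictFirst h (EuclideanSpace.basisFun (Fin d) ℝ i)) = inner ℝ y z := by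
  have := (EuclideanSpace.basisFun (Fin d) ℝ).sum_inner_mul_inner
    ((restrictFirst h).adjoint y) ((restrictFirst h).adjoint z)
  rw [ContinuousLinearMap.adjoint_inner_left, restrictFirst_adjoint] at this
  rw [← this]
  refine Finset.sum_congr rfl fun i _ => ?_
  rw [← ContinuousLinearMap.adjoint_inner_left, ← ContinuousLinearMap.adjoint_inner_left,
    real_inner_comm ((restrictFirst h).adjoint z)]

theorem sum_norm_sq_restrictFirst {d k : ℕ} (h : k ≤ d) :
    ∑ i : Fin d, ‖restrictFirst h (EuclideanSpace.basisFun (Fin d) ℝ i)‖ ^ 2 = k := by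
  calc _ = ∑ i : Fin d, ∑ j : Fin k, inner ℝ (EuclideanSpace.basisFun (Fin k) ℝ j)
        (restrictFirst h (EuclideanSpace.basisFun (Fin d) ℝ i)) *
        inner ℝ (EuclideanSpace.basisFun (Fin k) ℝ j)
        (restrictFirst h (EuclideanSpace.basisFun (Fin d) ℝ i)) := by
        refine Finset.sum_congr rfl fun i _ => ?_
        rw [← real_inner_self_eq_norm_sq,
          ← (EuclideanSpace.basisFun (Fin k) ℝ).sum_inner_mul_inner]
        refine Finset.sum_congr rfl fun j _ => ?_
        rw [real_inner_comm]
    _ = k := by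
        rw [Finset.sum_comm]
        simp only [sum_inner_restrictFirst]
        simp

theorem lipschitzWith_negNormProj {d k : ℕ} (h : k ≤ d) : LipschitzWith 1 (negNormProj d k) := by
  refine LipschitzWith.of_dist_le_mul fun x y => ?_
  rw [negNormProj_eq h, negNormProj_eq h, dist_neg_neg, NNReal.coe_one, one_mul, dist_eq_norm x y]
  refine (dist_norm_norm_le _ _).trans ?_
  rw [← map_sub]
  exact norm_restrictFirst_le h _

theorem concaveOn_negNormProj {d k : ℕ} (h : k ≤ d) : ConcaveOn ℝ univ (negNormProj d k) := by
  have : negNormProj d k = fun x => -‖restrictFirst h x‖ := funext (negNormProj_eq h)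
  rw [this]
  exact ((convexOn_univ_norm (E := Rd k)).comp_linearMap (restrictFirst h).toLinearMap).neg

/-! ### Comparison of viscosity solutions with smooth functions -/

theorem norm_gradient_eq {d : ℕ} (f : Rd d → ℝ) (x : Rd d) : ‖gradient f x‖ = ‖fderiv ℝ f x‖ := by
  rw [gradient, LinearIsometryEquiv.norm_map]

/-- The quadratic barrier `e^{4(T-t)} (1 + |x|²)`. -/
noncomputable def quadBarrier (d : ℕ) (T : ℝ) (p : ℝ × Rd d) : ℝ :=
  Real.exp (4 * (T - p.1)) * (1 + ‖p.2‖ ^ 2)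

theorem contDiff_quadBarrier (d : ℕ) (T : ℝ) {n : WithTop ℕ∞} : ContDiff ℝ n (quadBarrier d T) :=
  (Real.contDiff_exp.comp (contDiff_const.mul (contDiff_const.sub contDiff_fst))).mul
    (contDiff_const.add (contDiff_snd.norm_sq ℝ))

theorem hasDerivAt_quadBarrier (d : ℕ) (T t : ℝ) (x : Rd d) :
    HasDerivAt (fun s => quadBarrier d T (s, x)) (-4 * quadBarrier d T (t, x)) t := by
  have h := ((((hasDerivAt_id t).const_sub T).const_mul 4).exp).mul_const (1 + ‖x‖ ^ 2)
  refine h.congr_deriv ?_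
  simp only [quadBarrier, id]; ring

theorem hasFDerivAt_quadBarrier (d : ℕ) (T t : ℝ) (x : Rd d) :
    HasFDerivAt (fun y => quadBarrier d T (t, y))
      (Real.exp (4 * (T - t)) • (2 • innerSL ℝ x)) x := by
  exact (((hasStrictFDerivAt_norm_sq x).hasFDerivAt).const_add 1).const_mul (Real.exp (4 * (T - t)))

theorem HasLinearGrowth.le_quadBarrier {d : ℕ} {T : ℝ} {φ : ℝ → Rd d → ℝ}
    (h : HasLinearGrowth d T φ) {δ : ℝ} (hδ : 0 < δ) :
    ∃ R : ℝ, ∀ t ∈ Icc 0 T, ∀ x : Rd d, R < ‖x‖ → φ t x ≤ δ * quadBarrier d T (t, x) := by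
  obtain ⟨C, hC⟩ := h
  refine ⟨max 1 (2 * C / δ), fun t ht x hx => (le_abs_self _).trans ((hC t ht x).trans ?_)⟩
  have h1 : 1 < ‖x‖ := (le_max_left _ _).trans_lt hx
  have h2 : 2 * C < ‖x‖ * δ := (div_lt_iff₀ hδ).1 ((le_max_right _ _).trans_lt hx)
  have h3 : 1 ≤ Real.exp (4 * (T - t)) := Real.one_le_exp (by linarith [ht.2])
  have h4 : δ * ‖x‖ ^ 2 ≤ δ * quadBarrier d T (t, x) := by
    refine mul_le_mul_of_nonneg_left ?_ hδ.le
    have := mul_le_mul_of_nonneg_right h3 (show 0 ≤ 1 + ‖x‖ ^ 2 by positivity)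
    simp only [quadBarrier]; linarith
  refine le_trans ?_ h4
  rcases le_or_gt C 0 with hC0 | hC0
  · have : C * (1 + ‖x‖) ≤ 0 := mul_nonpos_of_nonpos_of_nonneg hC0 (by positivity)
    exact this.trans (by positivity)
  · nlinarith

theorem HasLinearGrowth.sub {d : ℕ} {T : ℝ} {φ ψ : ℝ → Rd d → ℝ} (h : HasLinearGrowth d T φ)
    (h' : HasLinearGrowth d T ψ) : HasLinearGrowth d T (fun t x => φ t x - ψ t x) := by
  obtain ⟨C, hC⟩ := h
  obtain ⟨C', hC'⟩ := h'
  refine ⟨C + C', fun t ht x => ?_⟩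
  have := abs_sub (φ t x) (ψ t x)
  linarith [hC t ht x, hC' t ht x]

theorem contDiffOn_const_div_fst {d : ℕ} (T δ : ℝ) {n : WithTop ℕ∞} :
    ContDiffOn ℝ n (fun p : ℝ × Rd d => δ / p.1) (Ioo 0 T ×ˢ univ) :=
  contDiffOn_const.div contDiff_fst.contDiffOn fun _ hp => hp.1.1.ne'

theorem hasDerivAt_const_div {δ t : ℝ} (ht : 0 < t) :
    HasDerivAt (fun s => δ / s) (-(δ / t ^ 2)) t := by
  refine ((hasDerivAt_const t δ).div (hasDerivAt_id t) ht.ne').congr_deriv ?_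
  simp only [id]; ring

/-- A viscosity subsolution lies below a smooth function of the form
`(t,x) ↦ m(x) - (T-t)/2` with `|∇m| = 1` if it does so at time `T`. -/
theorem IsViscosityHJSolution.le_of_smooth {d : ℕ} {T : ℝ} (hT : 0 < T) {g : Rd d → ℝ}
    {u : ℝ → Rd d → ℝ} (hu : IsViscosityHJSolution d T (fun _ => 0) g u) {m : Rd d → ℝ}
    (hm : ContDiff ℝ 1 m) (hm1 : ∀ x, ‖fderiv ℝ m x‖ = 1)
    (hgrow : HasLinearGrowth d T fun t x => m x - (T - t) / 2)
    (hg : ∀ x, g x ≤ m x) : ∀ t ∈ Icc 0 T, ∀ x, u t x ≤ m x - (T - t) / 2 := by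
  suffices h : ∀ t ∈ Icc 0 T, ∀ x, (fun p : ℝ × Rd d => u p.1 p.2 - (m p.2 - (T - p.1) / 2)) (t, x)
      ≤ 0 from fun t ht x => sub_nonpos.1 (h t ht x)
  have hmc : Continuous fun p : ℝ × Rd d => m p.2 - (T - p.1) / 2 := by
    have := hm.continuous
    fun_prop
  refine nonpos_of_no_penalized_max hT (ρ := quadBarrier d T) (hu.continuousOn.sub
    hmc.continuousOn) (contDiff_quadBarrier d T (n := 0)).continuous
    (fun t _ x => by simp only [quadBarrier]; positivity)
    (fun δ hδ => (hu.linearGrowth.sub hgrow).le_quadBarrier hδ)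
    (fun x => by simpa [hu.terminal] using hg x) ?_
  filter_upwards [self_mem_nhdsWithin] with δ hδ t ht x hmax
  replace hδ : 0 < δ := hδ
  set χ : ℝ × Rd d → ℝ := fun p => m p.2 - (T - p.1) / 2 + δ * quadBarrier d T p + δ / p.1 with hχ
  have hsub := hu.subsolution χ ?_ t ht x ?_
  · have hd : HasDerivAt (fun s => χ (s, x))
        (1 / 2 + δ * (-4 * quadBarrier d T (t, x)) + -(δ / t ^ 2)) t := by
      refine (HasDerivAt.add ?_ ((hasDerivAt_quadBarrier d T t x).const_mul δ)).add
        (hasDerivAt_const_div ht.1)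
      exact ((((hasDerivAt_id t).const_sub T).div_const 2).const_sub (m x)).congr_deriv (by ring)
    have hf : HasFDerivAt (fun y => χ (t, y))
        (fderiv ℝ m x + δ • (Real.exp (4 * (T - t)) • (2 • innerSL ℝ x))) x := by
      exact (((hm.differentiable one_ne_zero x).hasFDerivAt.sub_const ((T - t) / 2)).add
        ((hasFDerivAt_quadBarrier d T t x).const_mul δ)).add_const (δ / t)
    rw [hjOperator, norm_gradient_eq, hd.deriv, hf.fderiv] at hsub
    have hE : 0 < Real.exp (4 * (T - t)) := Real.exp_pos _
    set E := Real.exp (4 * (T - t)) with hEdef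
    have hq : quadBarrier d T (t, x) = E * (1 + ‖x‖ ^ 2) := rfl
    have hn : ‖δ • (E • (2 • innerSL ℝ x))‖ = δ * (E * (2 * ‖x‖)) := by
      rw [norm_smul, norm_smul, ← Nat.cast_smul_eq_nsmul ℝ, norm_smul, innerSL_apply_norm]
      simp [abs_of_pos hδ, abs_of_pos hE]
    have hlow : 1 - δ * (E * (2 * ‖x‖)) ≤ ‖fderiv ℝ m x + δ • (E • (2 • innerSL ℝ x))‖ := by
      have h := norm_sub_norm_le (fderiv ℝ m x) (-(δ • (E • (2 • innerSL ℝ x))))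
      rwa [norm_neg, hn, hm1, sub_neg_eq_add] at h
    have hlow2 : 1 - 2 * (δ * (E * (2 * ‖x‖))) ≤
        ‖fderiv ℝ m x + δ • (E • (2 • innerSL ℝ x))‖ ^ 2 := by
      set N := ‖fderiv ℝ m x + δ • (E • (2 • innerSL ℝ x))‖
      nlinarith [sq_nonneg (N - 1)]
    have hdt : 0 < δ / t ^ 2 := div_pos hδ (pow_pos ht.1 2)
    have hδE : 0 < δ * E := mul_pos hδ hE
    rw [hq] at hsub
    nlinarith [mul_nonneg hδE.le (sq_nonneg (‖x‖ - 1))]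
  · exact (((hm.comp contDiff_snd).sub ((contDiff_const.sub contDiff_fst).div_const 2)).add
      (contDiff_const.mul (contDiff_quadBarrier d T))).contDiffOn.add (contDiffOn_const_div_fst T δ)
  · have e : (fun p : ℝ × Rd d => u p.1 p.2 - χ p) = fun p =>
        u p.1 p.2 - (m p.2 - (T - p.1) / 2) - δ * quadBarrier d T p - δ / p.1 := by
      funext p
      simp only [hχ]; ring
    rw [e]; exact hmax

/-- A viscosity supersolution lies above a smooth function of the form
`(t,x) ↦ m(x) - (T-t)/2` with `|∇m| ≤ 1` if it does so at time `T`. -/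
theorem IsViscosityHJSolution.ge_of_smooth {d : ℕ} {T : ℝ} (hT : 0 < T) {g : Rd d → ℝ}
    {u : ℝ → Rd d → ℝ} (hu : IsViscosityHJSolution d T (fun _ => 0) g u) {m : Rd d → ℝ}
    (hm : ContDiff ℝ 1 m) (hm1 : ∀ x, ‖fderiv ℝ m x‖ ≤ 1)
    (hgrow : HasLinearGrowth d T fun t x => m x - (T - t) / 2)
    (hg : ∀ x, m x ≤ g x) : ∀ t ∈ Icc 0 T, ∀ x, m x - (T - t) / 2 ≤ u t x := by
  suffices h : ∀ t ∈ Icc 0 T, ∀ x, (fun p : ℝ × Rd d => (m p.2 - (T - p.1) / 2) - u p.1 p.2) (t, x)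
      ≤ 0 from fun t ht x => sub_nonpos.1 (h t ht x)
  have hmc : Continuous fun p : ℝ × Rd d => m p.2 - (T - p.1) / 2 := by
    have := hm.continuous
    fun_prop
  refine nonpos_of_no_penalized_max hT (ρ := quadBarrier d T) (hmc.continuousOn.sub
    hu.continuousOn) (contDiff_quadBarrier d T (n := 0)).continuous
    (fun t _ x => by simp only [quadBarrier]; positivity)
    (fun δ hδ => (hgrow.sub hu.linearGrowth).le_quadBarrier hδ)
    (fun x => by simpa [hu.terminal] using hg x) ?_
  have hsmall : ∀ᶠ δ in 𝓝[>] (0 : ℝ), δ < 1 / (2 * Real.exp (4 * T)) :=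
    tendsto_nhdsWithin_of_tendsto_nhds tendsto_id |>.eventually_lt_const (by positivity)
  filter_upwards [self_mem_nhdsWithin, hsmall] with δ hδ hδs t ht x hmax
  replace hδ : 0 < δ := hδ
  set χ : ℝ × Rd d → ℝ := fun p => m p.2 - (T - p.1) / 2 - δ * quadBarrier d T p - δ / p.1 with hχ
  have hsup := hu.supersolution χ ?_ t ht x ?_
  · have hd : HasDerivAt (fun s => χ (s, x))
        (1 / 2 - δ * (-4 * quadBarrier d T (t, x)) - -(δ / t ^ 2)) t := by
      refine (HasDerivAt.sub ?_ ((hasDerivAt_quadBarrier d T t x).const_mul δ)).sub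
        (hasDerivAt_const_div ht.1)
      exact ((((hasDerivAt_id t).const_sub T).div_const 2).const_sub (m x)).congr_deriv (by ring)
    have hf : HasFDerivAt (fun y => χ (t, y))
        (fderiv ℝ m x - δ • (Real.exp (4 * (T - t)) • (2 • innerSL ℝ x))) x := by
      exact (((hm.differentiable one_ne_zero x).hasFDerivAt.sub_const ((T - t) / 2)).sub
        ((hasFDerivAt_quadBarrier d T t x).const_mul δ)).sub_const (δ / t)
    rw [hjOperator, norm_gradient_eq, hd.deriv, hf.fderiv] at hsup
    have hE : 0 < Real.exp (4 * (T - t)) := Real.exp_pos _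
    have hEle : Real.exp (4 * (T - t)) ≤ Real.exp (4 * T) :=
      Real.exp_le_exp.2 (by linarith [ht.1])
    set E := Real.exp (4 * (T - t)) with hEdef
    have hq : quadBarrier d T (t, x) = E * (1 + ‖x‖ ^ 2) := rfl
    have hn : ‖δ • (E • (2 • innerSL ℝ x))‖ = δ * (E * (2 * ‖x‖)) := by
      rw [norm_smul, norm_smul, ← Nat.cast_smul_eq_nsmul ℝ, norm_smul, innerSL_apply_norm]
      simp [abs_of_pos hδ, abs_of_pos hE]
    have hup : ‖fderiv ℝ m x - δ • (E • (2 • innerSL ℝ x))‖ ≤ 1 + δ * E * (2 * ‖x‖) := by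
      have h := norm_sub_le (fderiv ℝ m x) (δ • (E • (2 • innerSL ℝ x)))
      rw [hn] at h
      linarith [hm1 x]
    have hup2 := pow_le_pow_left₀ (norm_nonneg _) hup 2
    have hdt : 0 < δ / t ^ 2 := div_pos hδ (pow_pos ht.1 2)
    have hδE : 0 < δ * E := mul_pos hδ hE
    have hδE2 : 2 * (δ * E) ≤ 1 := by
      rw [lt_div_iff₀ (by positivity)] at hδs
      nlinarith
    rw [hq] at hsup
    nlinarith [mul_nonneg hδE.le (sq_nonneg (‖x‖ - 1)),
      mul_nonneg (mul_nonneg hδE.le (sq_nonneg ‖x‖)) (sub_nonneg.2 hδE2)]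
  · exact (((hm.comp contDiff_snd).sub ((contDiff_const.sub contDiff_fst).div_const 2)).sub
      (contDiff_const.mul (contDiff_quadBarrier d T))).contDiffOn.sub (contDiffOn_const_div_fst T δ)
  · have e : (fun p : ℝ × Rd d => u p.1 p.2 - χ p) = fun p =>
        -(m p.2 - (T - p.1) / 2 - u p.1 p.2 - δ * quadBarrier d T p - δ / p.1) := by
      funext p
      simp only [hχ]; ring
    rw [e]; exact hmax.neg

/-! ### The inviscid problem -/

theorem HasLinearGrowth.of_lipschitzWith {d : ℕ} {T : ℝ} {m : Rd d → ℝ} (hm : LipschitzWith 1 m) :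
    HasLinearGrowth d T fun t x => m x - (T - t) / 2 := by
  refine ⟨|m 0| + T + 1, fun t ht x => ?_⟩
  have h1 : |m x - m 0| ≤ ‖x‖ := by
    simpa [Real.dist_eq] using hm.dist_le_mul x 0
  have h2 := ht.1
  have h3 := ht.2
  have h4 := neg_abs_le (m 0)
  have h5 := le_abs_self (m 0)
  have h6 := abs_nonneg (m 0)
  have h7 := norm_nonneg x
  have h8 : 0 ≤ (|m 0| + T) * ‖x‖ := by have : 0 ≤ T := h2.trans h3; positivity
  rw [abs_le] at h1 ⊢
  constructor <;> nlinarith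

/-- Every vector has a unit direction in which its norm grows at unit speed. -/
theorem exists_unit_norm_add_smul {k : ℕ} (hk : 1 ≤ k) (y : Rd k) :
    ∃ v : Rd k, ‖v‖ = 1 ∧ ∀ r : ℝ, 0 ≤ r → ‖y + r • v‖ = ‖y‖ + r := by
  by_cases hy : y = 0
  · refine ⟨EuclideanSpace.basisFun (Fin k) ℝ ⟨0, hk⟩, by simp, fun r hr => ?_⟩
    rw [hy, zero_add, norm_zero, zero_add, norm_smul, OrthonormalBasis.norm_eq_one, mul_one,
      Real.norm_of_nonneg hr]
  · have hy' : 0 < ‖y‖ := norm_pos_iff.2 hy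
    refine ⟨‖y‖⁻¹ • y, by rw [norm_smul, norm_inv, norm_norm, inv_mul_cancel₀ hy'.ne'],
      fun r hr => ?_⟩
    have : y + r • ‖y‖⁻¹ • y = (1 + r * ‖y‖⁻¹) • y := by rw [add_smul, one_smul, smul_smul]
    rw [this, norm_smul, Real.norm_of_nonneg (by positivity)]
    field_simp

theorem fderiv_apply_le_of_eventually_le {d : ℕ} {χ : Rd d → ℝ} {x e : Rd d} {c : ℝ}
    (hχ : DifferentiableAt ℝ χ x)
    (h : ∀ᶠ r in 𝓝[>] (0 : ℝ), χ (x + r • e) - χ x ≤ c * r) : fderiv ℝ χ x e ≤ c := by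
  have hl : HasDerivAt (fun r : ℝ => χ (x + r • e)) (fderiv ℝ χ x e) 0 := by
    have h1 : HasDerivAt (fun r : ℝ => x + r • e) e 0 := by
      simpa using ((hasDerivAt_id (0 : ℝ)).smul_const e).const_add x
    have h2 : HasFDerivAt χ (fderiv ℝ χ x) (x + (0 : ℝ) • e) := by simpa using hχ.hasFDerivAt
    exact h2.comp_hasDerivAt _ h1
  have hs := hl.tendsto_slope_zero_right
  refine le_of_tendsto hs ?_
  filter_upwards [h, self_mem_nhdsWithin] with r hr hr0
  have hr0' : (0 : ℝ) < r := hr0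
  simp only [zero_add, zero_smul, add_zero, smul_eq_mul]
  rw [inv_mul_le_iff₀ hr0']; linarith

/-- At a local extremum `∂_t χ = 1/2` holds; the Lipschitz bound on `g_k` gives `|∇χ| ≤ 1` at a
maximum, and a direction of decrease at unit speed gives `|∇χ| ≥ 1` at a minimum, also at the points
where `g_k` is not differentiable. -/
theorem isViscosityHJSolution_explicit {d k : ℕ} (hk : 1 ≤ k) (h : k ≤ d) (T : ℝ) :
    IsViscosityHJSolution d T (fun _ => 0) (negNormProj d k)
      (fun t x => negNormProj d k x - (T - t) / 2) := by
  have hlip := lipschitzWith_negNormProj h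
  have hcont := hlip.continuous
  have hdiff : ∀ χ : ℝ × Rd d → ℝ, ContDiffOn ℝ 1 χ (Ioo 0 T ×ˢ univ) → ∀ t ∈ Ioo (0 : ℝ) T,
      ∀ x : Rd d, DifferentiableAt ℝ (fun s => χ (s, x)) t ∧
        DifferentiableAt ℝ (fun y => χ (t, y)) x := by
    intro χ hχ t ht x
    have h1 : DifferentiableAt ℝ χ (t, x) :=
      (hχ.contDiffAt ((isOpen_Ioo.prod isOpen_univ).mem_nhds
        (show (t, x) ∈ Ioo 0 T ×ˢ univ from ⟨ht, mem_univ _⟩))).differentiableAt one_ne_zero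
    exact ⟨h1.comp t (differentiableAt_id.prodMk (differentiableAt_const x)),
      h1.comp x ((differentiableAt_const t).prodMk differentiableAt_id)⟩
  -- at a local extremum of `φ - χ` the function `s ↦ φ s x - χ (s,x)` is critical
  have htime : ∀ χ : ℝ × Rd d → ℝ, ContDiffOn ℝ 1 χ (Ioo 0 T ×ˢ univ) → ∀ t ∈ Ioo (0 : ℝ) T,
      ∀ x : Rd d, IsLocalExtr (fun p : ℝ × Rd d => negNormProj d k p.2 - (T - p.1) / 2 - χ p)
        (t, x) → deriv (fun s => χ (s, x)) t = 1 / 2 := by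
    intro χ hχ t ht x hext
    have h1 : IsLocalExtr (fun s => negNormProj d k x - (T - s) / 2 - χ (s, x)) t := by
      have hc : Tendsto (fun s : ℝ => (s, x)) (𝓝 t) (𝓝 (t, x)) :=
        (continuous_id.prodMk continuous_const).tendsto' _ _ rfl
      exact hext.elim (fun h => Or.inl (hc.eventually h)) fun h => Or.inr (hc.eventually h)
    have h2 : HasDerivAt (fun s => negNormProj d k x - (T - s) / 2 - χ (s, x))
        (1 / 2 - deriv (fun s => χ (s, x)) t) t :=
      (((((hasDerivAt_id t).const_sub T).div_const 2).const_sub (negNormProj d k x)).congr_deriv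
        (show -(-1 / 2) = (1 / 2 : ℝ) by norm_num)).sub (hdiff χ hχ t ht x).1.hasDerivAt
    have := h1.hasDerivAt_eq_zero h2
    linarith
  refine ⟨by fun_prop, .of_lipschitzWith hlip, ?_, ?_, fun x => by simp⟩
  · intro χ hχ t ht x hmax
    have hsp : ∀ᶠ y in 𝓝 x, negNormProj d k y - (T - t) / 2 - χ (t, y) ≤
        negNormProj d k x - (T - t) / 2 - χ (t, x) :=
      ((continuous_const.prodMk continuous_id).tendsto' x (t, x) rfl).eventually hmax
    have hd := (hdiff χ hχ t ht x).2
    -- `χ(t,·)` decreases at most at unit speed, because `g_k` is `1`-Lipschitz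
    have hle : ‖fderiv ℝ (fun y => χ (t, y)) x‖ ≤ 1 := by
      have hneg : ∀ e : Rd d, -‖e‖ ≤ fderiv ℝ (fun y => χ (t, y)) x e := by
        intro e
        have := fderiv_apply_le_of_eventually_le (χ := fun y => -χ (t, y)) (x := x) (e := e)
          (c := ‖e‖) hd.neg ?_
        · rw [fderiv_fun_neg] at this
          simpa [neg_le] using this
        · have hc : Tendsto (fun r : ℝ => x + r • e) (𝓝[>] 0) (𝓝 x) :=
            tendsto_nhdsWithin_of_tendsto_nhds
              ((by fun_prop : Continuous fun r : ℝ => x + r • e).tendsto' _ _ (by simp))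
          filter_upwards [hc.eventually hsp, self_mem_nhdsWithin] with r hr hr0
          have hr0' : (0 : ℝ) < r := hr0
          have hl : |negNormProj d k x - negNormProj d k (x + r • e)| ≤ ‖e‖ * r := by
            have := hlip.dist_le_mul x (x + r • e)
            rwa [Real.dist_eq, NNReal.coe_one, one_mul, dist_self_add_right, norm_smul,
              Real.norm_of_nonneg hr0'.le, mul_comm] at this
          have := (abs_le.1 hl).2
          linarith
      refine ContinuousLinearMap.opNorm_le_bound _ zero_le_one fun e => ?_
      rw [one_mul, Real.norm_eq_abs, abs_le]
      refine ⟨hneg e, ?_⟩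
      have := hneg (-e)
      rw [norm_neg, map_neg] at this
      linarith
    rw [hjOperator, norm_gradient_eq, htime χ hχ t ht x (Or.inr hmax)]
    nlinarith [norm_nonneg (fderiv ℝ (fun y => χ (t, y)) x)]
  · intro χ hχ t ht x hmin
    have hsp : ∀ᶠ y in 𝓝 x, negNormProj d k x - (T - t) / 2 - χ (t, x) ≤
        negNormProj d k y - (T - t) / 2 - χ (t, y) :=
      ((continuous_const.prodMk continuous_id).tendsto' x (t, x) rfl).eventually hmin
    have hd := (hdiff χ hχ t ht x).2
    obtain ⟨v, hv1, hv⟩ := exists_unit_norm_add_smul hk (restrictFirst h x)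
    -- moving along `v` decreases `g_k` at unit speed
    set e := (restrictFirst h).adjoint v with he
    have hge : fderiv ℝ (fun y => χ (t, y)) x e ≤ -1 := by
      refine fderiv_apply_le_of_eventually_le hd ?_
      have hc : Tendsto (fun r : ℝ => x + r • e) (𝓝[>] 0) (𝓝 x) :=
        tendsto_nhdsWithin_of_tendsto_nhds
          ((by fun_prop : Continuous fun r : ℝ => x + r • e).tendsto' _ _ (by simp))
      filter_upwards [hc.eventually hsp, self_mem_nhdsWithin] with r hr hr0
      have hr0' : (0 : ℝ) < r := hr0
      rw [negNormProj_eq h, negNormProj_eq h, map_add, map_smul, he, restrictFirst_adjoint,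
        hv r hr0'.le] at hr
      linarith
    have hnorm : 1 ≤ ‖fderiv ℝ (fun y => χ (t, y)) x‖ := by
      have h1 := (fderiv ℝ (fun y => χ (t, y)) x).le_opNorm e
      rw [he, norm_adjoint_restrictFirst, hv1, mul_one, ← he, Real.norm_eq_abs] at h1
      have := neg_abs_le (fderiv ℝ (fun y => χ (t, y)) x e)
      linarith
    rw [hjOperator, norm_gradient_eq, htime χ hχ t ht x (Or.inl hmin)]
    nlinarith

/-- The solution is squeezed between the affine solutions `-⟪v, P_k x⟫ - (T-t)/2`, `|v| = 1`, whose
infimum it is, and the smooth subsolutions `-√(η² + |P_k x|²) - (T-t)/2`. -/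
theorem IsViscosityHJSolution.eq_explicit {d k : ℕ} (hk : 1 ≤ k) (h : k ≤ d) {T : ℝ} (hT : 0 < T)
    {u : ℝ → Rd d → ℝ} (hu : IsViscosityHJSolution d T (fun _ => 0) (negNormProj d k) u) :
    ∀ t ∈ Icc 0 T, ∀ x, u t x = negNormProj d k x - (T - t) / 2 := by
  intro t ht x
  apply le_antisymm
  · obtain ⟨v, hv1, hv⟩ := exists_unit_norm_add_smul hk (restrictFirst h x)
    set e := (restrictFirst h).adjoint v with he
    have he1 : ‖e‖ = 1 := by rw [he, norm_adjoint_restrictFirst, hv1]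
    have hxe : inner ℝ e x = ‖restrictFirst h x‖ := by
      rw [he, ContinuousLinearMap.adjoint_inner_left, real_inner_comm]
      have h2 := norm_add_sq_real (restrictFirst h x) v
      have h1 := hv 1 zero_le_one
      rw [one_smul] at h1
      rw [h1, hv1] at h2
      linarith
    have hfd : ∀ y, HasFDerivAt (fun y : Rd d => -inner ℝ e y) (-(innerSL ℝ e)) y := fun y =>
      (innerSL ℝ e).hasFDerivAt.neg
    have hn : ∀ y, ‖fderiv ℝ (fun y : Rd d => -inner ℝ e y) y‖ = 1 := fun y => by
      rw [(hfd y).fderiv, norm_neg, innerSL_apply_norm, he1]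
    have := hu.le_of_smooth hT (m := fun y => -inner ℝ e y) ?_ hn ?_ ?_ t ht x
    · rw [hxe] at this
      rwa [negNormProj_eq h]
    · exact ((innerSL ℝ e).contDiff).neg
    · refine .of_lipschitzWith (lipschitzWith_of_nnnorm_fderiv_le
        (fun y => (hfd y).differentiableAt) fun y => ?_)
      rw [← NNReal.coe_le_coe, coe_nnnorm, hn y, NNReal.coe_one]
    · intro y
      rw [negNormProj_eq h, neg_le_neg_iff, he, ContinuousLinearMap.adjoint_inner_left]
      have := real_inner_le_norm v (restrictFirst h y)
      rwa [hv1, one_mul] at this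
  · have hη : ∀ η : ℝ, 0 < η →
        -√(η ^ 2 + ‖restrictFirst h x‖ ^ 2) - (T - t) / 2 ≤ u t x := by
      intro η hη
      have hpos : ∀ y : Rd d, η ^ 2 + ‖restrictFirst h y‖ ^ 2 ≠ 0 := fun y => by positivity
      have hsm : ContDiff ℝ 1 fun y : Rd d => -√(η ^ 2 + ‖restrictFirst h y‖ ^ 2) :=
        ((contDiff_const.add ((restrictFirst h).contDiff.norm_sq ℝ)).sqrt hpos).neg
      have hlip : LipschitzWith 1 fun y : Rd d => -√(η ^ 2 + ‖restrictFirst h y‖ ^ 2) := by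
        refine LipschitzWith.of_dist_le_mul fun y z => ?_
        rw [dist_neg_neg, NNReal.coe_one, one_mul, Real.dist_eq, dist_eq_norm y z]
        have hyz : |‖restrictFirst h y‖ - ‖restrictFirst h z‖| ≤ ‖y - z‖ := by
          refine (abs_norm_sub_norm_le _ _).trans ?_
          rw [← map_sub]
          exact norm_restrictFirst_le h _
        refine le_trans ?_ hyz
        set a := ‖restrictFirst h y‖
        set b := ‖restrictFirst h z‖
        have ha : 0 ≤ a := norm_nonneg _
        have hb : 0 ≤ b := norm_nonneg _
        have hA := Real.sq_sqrt (show 0 ≤ η ^ 2 + a ^ 2 by positivity)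
        have hB := Real.sq_sqrt (show 0 ≤ η ^ 2 + b ^ 2 by positivity)
        have hAa : a ≤ √(η ^ 2 + a ^ 2) := Real.le_sqrt_of_sq_le (by nlinarith)
        have hBb : b ≤ √(η ^ 2 + b ^ 2) := Real.le_sqrt_of_sq_le (by nlinarith)
        set A := √(η ^ 2 + a ^ 2)
        set B := √(η ^ 2 + b ^ 2)
        have hApos : 0 < A := Real.sqrt_pos.2 (by positivity)
        have hBpos : 0 < B := Real.sqrt_pos.2 (by positivity)
        have h1 : |A - B| * (A + B) = |a - b| * (a + b) := by
          rw [← abs_of_nonneg (show 0 ≤ A + B by linarith),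
            ← abs_of_nonneg (show 0 ≤ a + b by linarith), ← abs_mul, ← abs_mul]
          congr 1; nlinarith
        have h2 : |a - b| * (a + b) ≤ |a - b| * (A + B) :=
          mul_le_mul_of_nonneg_left (by linarith) (abs_nonneg _)
        rw [← h1] at h2
        exact le_of_mul_le_mul_right h2 (by linarith)
      refine hu.ge_of_smooth hT hsm (fun y => ?_) (.of_lipschitzWith hlip) (fun y => ?_) t ht x
      · simpa using norm_fderiv_le_of_lipschitz ℝ hlip (x₀ := y)
      · rw [negNormProj_eq h, neg_le_neg_iff]
        exact Real.le_sqrt_of_sq_le (by nlinarith)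
    have hlim : Tendsto (fun η : ℝ => -√(η ^ 2 + ‖restrictFirst h x‖ ^ 2) - (T - t) / 2) (𝓝[>] 0)
        (𝓝 (negNormProj d k x - (T - t) / 2)) := by
      refine tendsto_nhdsWithin_of_tendsto_nhds
        ((by fun_prop : Continuous fun η : ℝ =>
          -√(η ^ 2 + ‖restrictFirst h x‖ ^ 2) - (T - t) / 2).tendsto' _ _ ?_)
      rw [negNormProj_eq h, zero_pow two_ne_zero, zero_add, Real.sqrt_sq (norm_nonneg _)]
    exact le_of_tendsto hlim (by filter_upwards [self_mem_nhdsWithin] with η h using hη η h)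

/-! ### The Cole–Hopf transform and uniqueness for the viscous problem -/

/-- `f : ℝ → ℝ` is differentiable, with first and second derivatives `a` and `b` at `0`. -/
def HasTwoDerivsAtZero (f : ℝ → ℝ) (a b : ℝ) : Prop :=
  ∃ f' : ℝ → ℝ, (∀ r, HasDerivAt f (f' r) r) ∧ f' 0 = a ∧ HasDerivAt f' b 0

namespace HasTwoDerivsAtZero

variable {f g : ℝ → ℝ} {a b a' b' : ℝ}

theorem congr_second (h : HasTwoDerivsAtZero f a b) (hb : b = b') : HasTwoDerivsAtZero f a b' :=
  hb ▸ h

theorem deriv_deriv (h : HasTwoDerivsAtZero f a b) : deriv (deriv f) 0 = b := by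
  obtain ⟨f', h1, -, h3⟩ := h
  rw [show deriv f = f' from funext fun r => (h1 r).deriv, h3.deriv]

theorem sub (h : HasTwoDerivsAtZero f a b) (h' : HasTwoDerivsAtZero g a' b') :
    HasTwoDerivsAtZero (fun r => f r - g r) (a - a') (b - b') := by
  obtain ⟨f', h1, h2, h3⟩ := h
  obtain ⟨g', k1, k2, k3⟩ := h'
  exact ⟨fun r => f' r - g' r, fun r => (h1 r).sub (k1 r), by simp only [h2, k2], h3.sub k3⟩

theorem const_mul (c : ℝ) (h : HasTwoDerivsAtZero f a b) :
    HasTwoDerivsAtZero (fun r => c * f r) (c * a) (c * b) := by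
  obtain ⟨f', h1, h2, h3⟩ := h
  exact ⟨fun r => c * f' r, fun r => (h1 r).const_mul c, by simp only [h2], h3.const_mul c⟩

theorem mul (h : HasTwoDerivsAtZero f a b) (h' : HasTwoDerivsAtZero g a' b') :
    HasTwoDerivsAtZero (fun r => f r * g r) (a * g 0 + f 0 * a')
      (b * g 0 + 2 * (a * a') + f 0 * b') := by
  obtain ⟨f', h1, h2, h3⟩ := h
  obtain ⟨g', k1, k2, k3⟩ := h'
  refine ⟨fun r => f' r * g r + f r * g' r, fun r => (h1 r).mul (k1 r), by simp only [h2, k2],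
    ((h3.mul (k1 0)).add ((h1 0).mul k3)).congr_deriv ?_⟩
  rw [h2, k2]; ring

theorem exp (h : HasTwoDerivsAtZero f a b) :
    HasTwoDerivsAtZero (fun r => Real.exp (f r)) (Real.exp (f 0) * a)
      (Real.exp (f 0) * (a ^ 2 + b)) := by
  obtain ⟨f', h1, h2, h3⟩ := h
  refine ⟨fun r => Real.exp (f r) * f' r, fun r => (h1 r).exp, by simp only [h2],
    ((h1 0).exp.mul h3).congr_deriv ?_⟩
  rw [h2]; ring

theorem nonpos_of_isLocalMax (h : HasTwoDerivsAtZero f a b) (hmax : IsLocalMax f 0) : b ≤ 0 := by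
  by_contra! hb
  have hd := h.deriv_deriv
  have hmin : IsLocalMin f 0 := by
    obtain ⟨f', h1, -, -⟩ := h
    exact isLocalMin_of_deriv_deriv_pos (by rwa [hd]) hmax.deriv_eq_zero (h1 0).continuousAt
  have heq : f =ᶠ[𝓝 0] fun _ => f 0 := by
    filter_upwards [hmax, hmin] with r h1 h2 using le_antisymm h1 h2
  have := heq.deriv.deriv_eq
  simp [hd] at this
  exact hb.ne' this

end HasTwoDerivsAtZero

/-- The second derivative of `f` along a line is the Hessian evaluated twice at its direction. -/
theorem ContDiff.hasTwoDerivsAtZero_line {d : ℕ} {f : Rd d → ℝ} (hf : ContDiff ℝ 2 f)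
    (x e : Rd d) : HasTwoDerivsAtZero (fun r : ℝ => f (x + r • e)) (fderiv ℝ f x e)
      (iteratedFDeriv ℝ 2 f x ![e, e]) := by
  have hline : ∀ r : ℝ, HasDerivAt (fun r : ℝ => x + r • e) e r := fun r => by
    simpa using ((hasDerivAt_id r).smul_const e).const_add x
  refine ⟨fun r => fderiv ℝ f (x + r • e) e, fun r => ?_, by simp, ?_⟩
  · exact (hf.differentiable two_ne_zero _).hasFDerivAt.comp_hasDerivAt r (hline r)
  · have h1 : Differentiable ℝ (fderiv ℝ f) :=
      (hf.fderiv_right (m := 1) (by norm_num)).differentiable one_ne_zero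
    have h2 : HasFDerivAt (fderiv ℝ f) (fderiv ℝ (fderiv ℝ f) x) (x + (0 : ℝ) • e) := by
      simpa using (h1 x).hasFDerivAt
    have h3 : HasFDerivAt (fun y => fderiv ℝ f y e)
        ((ContinuousLinearMap.apply ℝ ℝ e).comp (fderiv ℝ (fderiv ℝ f) x)) (x + (0 : ℝ) • e) :=
      (ContinuousLinearMap.apply ℝ ℝ e).hasFDerivAt.comp _ h2
    refine (h3.comp_hasDerivAt (0 : ℝ) (hline 0)).congr_deriv ?_
    simp [iteratedFDeriv_two_apply]

theorem laplacian_eq_sum_basisFun {d : ℕ} (f : Rd d → ℝ) (x : Rd d) :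
    Laplacian.laplacian f x = ∑ i, iteratedFDeriv ℝ 2 f x
      ![EuclideanSpace.basisFun (Fin d) ℝ i, EuclideanSpace.basisFun (Fin d) ℝ i] := by
  rw [InnerProductSpace.laplacian_eq_iteratedFDeriv_orthonormalBasis f
    (EuclideanSpace.basisFun (Fin d) ℝ)]

theorem sum_fderiv_basisFun_sq {d : ℕ} (f : Rd d → ℝ) (x : Rd d) :
    ∑ i, (fderiv ℝ f x (EuclideanSpace.basisFun (Fin d) ℝ i)) ^ 2 = ‖gradient f x‖ ^ 2 := by
  rw [← real_inner_self_eq_norm_sq,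
    ← (EuclideanSpace.basisFun (Fin d) ℝ).sum_inner_mul_inner (gradient f x) (gradient f x)]
  refine Finset.sum_congr rfl fun i _ => ?_
  rw [real_inner_comm (gradient f x), inner_gradient_left]
  simp [sq]

/-- Second derivative along a line of the Cole–Hopf transform `exp(-φ/ε)`. -/
theorem ContDiff.hasTwoDerivsAtZero_exp_neg_div {d : ℕ} {f : Rd d → ℝ} (hf : ContDiff ℝ 2 f)
    (ε : ℝ) (x e : Rd d) : HasTwoDerivsAtZero (fun r : ℝ => Real.exp (-ε⁻¹ * f (x + r • e)))
      (Real.exp (-ε⁻¹ * f x) * (-ε⁻¹ * fderiv ℝ f x e))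
      (Real.exp (-ε⁻¹ * f x) *
        (ε⁻¹ ^ 2 * fderiv ℝ f x e ^ 2 - ε⁻¹ * iteratedFDeriv ℝ 2 f x ![e, e])) := by
  have := ((hf.hasTwoDerivsAtZero_line x e).const_mul (-ε⁻¹)).exp
  simp only [zero_smul, add_zero] at this
  convert this using 2
  ring

/-- Summing second derivatives over an orthonormal basis: the Laplacian of `exp(-φ/ε)` is
`exp(-φ/ε) (|∇φ|²/ε² - Δφ/ε)`. -/
theorem sum_second_derivs_exp_neg_div {d : ℕ} (f : Rd d → ℝ) (ε : ℝ) (x : Rd d) :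
    ∑ i, Real.exp (-ε⁻¹ * f x) *
      (ε⁻¹ ^ 2 * fderiv ℝ f x (EuclideanSpace.basisFun (Fin d) ℝ i) ^ 2 -
        ε⁻¹ * iteratedFDeriv ℝ 2 f x
          ![EuclideanSpace.basisFun (Fin d) ℝ i, EuclideanSpace.basisFun (Fin d) ℝ i]) =
    Real.exp (-ε⁻¹ * f x) *
      (ε⁻¹ ^ 2 * ‖gradient f x‖ ^ 2 - ε⁻¹ * Laplacian.laplacian f x) := by
  rw [← Finset.mul_sum, Finset.sum_sub_distrib, ← Finset.mul_sum, ← Finset.mul_sum,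
    sum_fderiv_basisFun_sq, laplacian_eq_sum_basisFun]

/-- The barrier `e^{λ(T-t)} ∑ᵢ cosh(b xᵢ)`, which outgrows `e^{C|x|}` when `b` is large. -/
noncomputable def coshBarrier (d : ℕ) (T lam b : ℝ) (p : ℝ × Rd d) : ℝ :=
  Real.exp (lam * (T - p.1)) * ∑ i, Real.cosh (b * p.2 i)

theorem continuous_coshBarrier (d : ℕ) (T lam b : ℝ) : Continuous (coshBarrier d T lam b) := by
  have : Continuous fun p : ℝ × Rd d => ∑ i, Real.cosh (b * p.2 i) :=
    continuous_finsetSum _ fun i _ => Real.continuous_cosh.comp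
      (continuous_const.mul ((EuclideanSpace.proj (𝕜 := ℝ) i).continuous.comp continuous_snd))
  unfold coshBarrier
  exact (by fun_prop : Continuous fun p : ℝ × Rd d => Real.exp (lam * (T - p.1))).mul this

theorem coshBarrier_nonneg (d : ℕ) (T lam b : ℝ) (p : ℝ × Rd d) : 0 ≤ coshBarrier d T lam b p :=
  mul_nonneg (Real.exp_pos _).le (Finset.sum_nonneg fun _ _ => (Real.cosh_pos _).le)

theorem hasDerivAt_coshBarrier (d : ℕ) (T lam b t : ℝ) (x : Rd d) :
    HasDerivAt (fun s => coshBarrier d T lam b (s, x)) (-lam * coshBarrier d T lam b (t, x)) t := by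
  have h := ((((hasDerivAt_id t).const_sub T).const_mul lam).exp).mul_const
    (∑ i, Real.cosh (b * x i))
  refine h.congr_deriv ?_
  simp only [coshBarrier, id]; ring

theorem hasTwoDerivsAtZero_coshBarrier (d : ℕ) (T lam b t : ℝ) (x : Rd d) (j : Fin d) :
    ∃ a, HasTwoDerivsAtZero
      (fun r : ℝ => coshBarrier d T lam b (t, x + r • EuclideanSpace.basisFun (Fin d) ℝ j)) a
      (Real.exp (lam * (T - t)) * (b ^ 2 * Real.cosh (b * x j))) := by
  set S := ∑ i ∈ Finset.univ.erase j, Real.cosh (b * x i) with hS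
  have hfun : (fun r : ℝ => coshBarrier d T lam b (t, x + r • EuclideanSpace.basisFun (Fin d) ℝ j))
      = fun r => Real.exp (lam * (T - t)) * (Real.cosh (b * (x j + r)) + S) := by
    funext r
    simp only [coshBarrier]
    rw [← Finset.add_sum_erase _ _ (Finset.mem_univ j), hS]
    congr 2
    · simp
    · refine Finset.sum_congr rfl fun i hi => ?_
      simp [Finset.ne_of_mem_erase hi]
  rw [hfun]
  have hl : ∀ r : ℝ, HasDerivAt (fun r => b * (x j + r)) b r := fun r => by
    simpa using ((hasDerivAt_id r).const_add (x j)).const_mul b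
  refine ⟨_, HasTwoDerivsAtZero.const_mul _
    ⟨fun r => Real.sinh (b * (x j + r)) * b, fun r => ((hl r).cosh).add_const S, rfl,
      (((hl 0).sinh).mul_const b).congr_deriv ?_⟩⟩
  rw [add_zero]; ring

theorem exists_exp_le_coshBarrier (d : ℕ) {T lam C δ : ℝ} (hlam : 0 ≤ lam) (hC : 0 ≤ C)
    (hδ : 0 < δ) : ∃ R : ℝ, ∀ t ∈ Icc 0 T, ∀ x : Rd d, R < ‖x‖ →
      Real.exp (C * (1 + ‖x‖)) ≤ δ * coshBarrier d T lam (d * (C + 1)) (t, x) := by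
  refine ⟨max 0 (C + Real.log (2 / δ)), fun t ht x hx => ?_⟩
  have hx0 : 0 < ‖x‖ := (le_max_left _ _).trans_lt hx
  have hxR : C + Real.log (2 / δ) < ‖x‖ := (le_max_right _ _).trans_lt hx
  -- some coordinate carries at least the fraction `1/d` of the norm
  obtain ⟨i, hi⟩ : ∃ i, ‖x‖ ≤ d * |x i| := by
    by_contra! hcon
    have h1 : ‖x‖ ≤ ∑ i, |x i| := by
      have h2 : x = ∑ i, x i • EuclideanSpace.basisFun (Fin d) ℝ i := by
        simpa using ((EuclideanSpace.basisFun (Fin d) ℝ).sum_repr x).symm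
      calc ‖x‖ = ‖∑ i, x i • EuclideanSpace.basisFun (Fin d) ℝ i‖ := by rw [← h2]
        _ ≤ ∑ i, ‖x i • EuclideanSpace.basisFun (Fin d) ℝ i‖ := norm_sum_le _ _
        _ = ∑ i, |x i| := by simp [norm_smul]
    have hne : (Finset.univ : Finset (Fin d)).Nonempty := by
      by_contra hemp
      rw [Finset.not_nonempty_iff_eq_empty] at hemp
      rw [hemp, Finset.sum_empty] at h1
      exact absurd h1 (not_le.2 hx0)
    have h3 := Finset.sum_lt_sum_of_nonempty hne fun i _ => hcon i
    rw [← Finset.mul_sum, Finset.sum_const, Finset.card_univ, Fintype.card_fin,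
      nsmul_eq_mul] at h3
    exact absurd (lt_of_mul_lt_mul_left h3 (Nat.cast_nonneg d)) (not_lt.2 h1)
  have hcosh : Real.exp ((C + 1) * ‖x‖) / 2 ≤ Real.cosh (d * (C + 1) * x i) := by
    rw [← Real.cosh_abs, Real.cosh_eq]
    have : (C + 1) * ‖x‖ ≤ |d * (C + 1) * x i| := by
      rw [abs_mul, abs_of_nonneg (by positivity : 0 ≤ (d : ℝ) * (C + 1))]
      nlinarith
    have := Real.exp_le_exp.2 this
    have := (Real.exp_pos (-|d * (C + 1) * x i|)).le
    linarith
  have hsum : Real.cosh (d * (C + 1) * x i) ≤ ∑ j, Real.cosh (d * (C + 1) * x j) :=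
    Finset.single_le_sum (f := fun j => Real.cosh (d * (C + 1) * x j))
      (fun j _ => (Real.cosh_pos _).le) (Finset.mem_univ i)
  have hone : 1 ≤ Real.exp (lam * (T - t)) :=
    Real.one_le_exp (mul_nonneg hlam (sub_nonneg.2 ht.2))
  have hbar : Real.exp ((C + 1) * ‖x‖) / 2 ≤ coshBarrier d T lam (d * (C + 1)) (t, x) := by
    refine (hcosh.trans hsum).trans (le_mul_of_one_le_left ?_ hone)
    exact Finset.sum_nonneg fun _ _ => (Real.cosh_pos _).le
  refine le_trans ?_ (mul_le_mul_of_nonneg_left hbar hδ.le)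
  have h5 : Real.exp (C * (1 + ‖x‖)) * (2 / δ) ≤ Real.exp ((C + 1) * ‖x‖) := by
    rw [← Real.exp_log (show 0 < 2 / δ by positivity), ← Real.exp_add]
    exact Real.exp_le_exp.2 (by linarith)
  rw [← le_div_iff₀ (by positivity)] at h5
  calc _ ≤ _ := h5
    _ = _ := by field_simp

/-- Comparison for the viscous problem: `exp(-ψ/ε) - exp(-φ/ε)` solves the backward heat equation and
has at most exponential growth. -/
theorem IsViscousHJSolution.le {d : ℕ} {T : ℝ} (hT : 0 < T) {ε : ℝ} (hε : 0 < ε) {g : Rd d → ℝ}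
    {φ ψ : ℝ → Rd d → ℝ} (hφ : IsViscousHJSolution d T ε (fun _ => 0) g φ)
    (hψ : IsViscousHJSolution d T ε (fun _ => 0) g ψ) :
    ∀ t ∈ Icc 0 T, ∀ x, φ t x ≤ ψ t x := by
  obtain ⟨C₀, hC₀⟩ := hψ.linearGrowth
  set C := ε⁻¹ * |C₀| with hC
  have hC0 : 0 ≤ C := by positivity
  set b : ℝ := d * (C + 1) with hb
  -- with this `lam` the barrier `ρ` satisfies `(∂_t + (ε/2) Δ) ρ = -ρ`
  set lam : ℝ := ε / 2 * b ^ 2 + 1 with hlam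
  set w : ℝ × Rd d → ℝ := fun p =>
    Real.exp (-ε⁻¹ * ψ p.1 p.2) - Real.exp (-ε⁻¹ * φ p.1 p.2) with hw
  suffices h : ∀ t ∈ Icc 0 T, ∀ x, w (t, x) ≤ 0 by
    intro t ht x
    have h1 := Real.exp_le_exp.1 (sub_nonpos.1 (h t ht x))
    have h2 : 0 < ε⁻¹ := inv_pos.2 hε
    nlinarith
  refine nonpos_of_no_penalized_max hT (ρ := coshBarrier d T lam b) ?_
    (continuous_coshBarrier d T lam b) (fun t _ x => coshBarrier_nonneg _ _ _ _ _) ?_ ?_ ?_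
  · exact ((continuousOn_const.mul hψ.continuousOn).rexp).sub
      ((continuousOn_const.mul hφ.continuousOn).rexp)
  · intro δ hδ
    obtain ⟨R, hR⟩ := exists_exp_le_coshBarrier d (T := T) (lam := lam) (by positivity) hC0 hδ
    refine ⟨R, fun t ht x hx => le_trans ?_ (hR t ht x hx)⟩
    have h1 : w (t, x) ≤ Real.exp (-ε⁻¹ * ψ t x) := sub_le_self _ (Real.exp_pos _).le
    refine h1.trans (Real.exp_le_exp.2 ?_)
    have h2 := (neg_le_abs _).trans (hC₀ t ht x)
    have h3 : C₀ * (1 + ‖x‖) ≤ |C₀| * (1 + ‖x‖) :=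
      mul_le_mul_of_nonneg_right (le_abs_self _) (by positivity)
    have h4 := mul_le_mul_of_nonneg_left (h2.trans h3) (inv_pos.2 hε).le
    rw [hC]; linarith
  · intro x
    simp [hw, hφ.terminal, hψ.terminal]
  · filter_upwards [self_mem_nhdsWithin] with δ hδ t ht x hmax
    replace hδ : 0 < δ := hδ
    have htime : ∀ η : ℝ → Rd d → ℝ, IsViscousHJSolution d T ε (fun _ => 0) g η →
        HasDerivAt (fun s => Real.exp (-ε⁻¹ * η s x))
          (Real.exp (-ε⁻¹ * η t x) * (-ε⁻¹ * deriv (fun s => η s x) t)) t := fun η hη =>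
      ((hη.regular.differentiableAt_time t ht x).hasDerivAt.const_mul _).exp
    have ht0 : HasDerivAt (fun s => w (s, x) - δ * coshBarrier d T lam b (s, x) - δ / s) _ t :=
      (((htime ψ hψ).sub (htime φ hφ)).sub
        ((hasDerivAt_coshBarrier d T lam b t x).const_mul δ)).sub (hasDerivAt_const_div ht.1)
    have hmt : IsLocalMax (fun s => w (s, x) - δ * coshBarrier d T lam b (s, x) - δ / s) t :=
      ((continuous_id.prodMk continuous_const).tendsto' t (t, x) rfl).eventually hmax
    have hcrit := hmt.hasDerivAt_eq_zero ht0
    have hsp : ∀ i, Real.exp (-ε⁻¹ * ψ t x) *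
        (ε⁻¹ ^ 2 * fderiv ℝ (ψ t) x (EuclideanSpace.basisFun (Fin d) ℝ i) ^ 2 -
          ε⁻¹ * iteratedFDeriv ℝ 2 (ψ t) x
            ![EuclideanSpace.basisFun (Fin d) ℝ i, EuclideanSpace.basisFun (Fin d) ℝ i]) -
        Real.exp (-ε⁻¹ * φ t x) *
        (ε⁻¹ ^ 2 * fderiv ℝ (φ t) x (EuclideanSpace.basisFun (Fin d) ℝ i) ^ 2 -
          ε⁻¹ * iteratedFDeriv ℝ 2 (φ t) x
            ![EuclideanSpace.basisFun (Fin d) ℝ i, EuclideanSpace.basisFun (Fin d) ℝ i]) -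
        δ * (Real.exp (lam * (T - t)) * (b ^ 2 * Real.cosh (b * x i))) ≤ 0 := by
      intro i
      set e := EuclideanSpace.basisFun (Fin d) ℝ i
      obtain ⟨a, ha⟩ := hasTwoDerivsAtZero_coshBarrier d T lam b t x i
      have h2 := ((((hψ.regular.contDiff_space t ht).hasTwoDerivsAtZero_exp_neg_div ε x e).sub
        ((hφ.regular.contDiff_space t ht).hasTwoDerivsAtZero_exp_neg_div ε x e)).sub
        (ha.const_mul δ))
      refine h2.nonpos_of_isLocalMax ?_
      have hc : Tendsto (fun r : ℝ => (t, x + r • e)) (𝓝 0) (𝓝 (t, x)) :=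
        (by fun_prop : Continuous fun r : ℝ => (t, x + r • e)).tendsto' _ _ (by simp)
      filter_upwards [hc.eventually hmax] with r hr
      simp only [hw] at hr
      simp only [zero_smul, add_zero]
      linarith
    -- summed over the basis, the second-order conditions bound the Laplacian
    have hsum := Finset.sum_nonpos fun i (_ : i ∈ Finset.univ) => hsp i
    rw [Finset.sum_sub_distrib, Finset.sum_sub_distrib, sum_second_derivs_exp_neg_div,
      sum_second_derivs_exp_neg_div, ← Finset.mul_sum, ← Finset.mul_sum, ← Finset.mul_sum] at hsum
    have hbar : Real.exp (lam * (T - t)) * (b ^ 2 * ∑ i, Real.cosh (b * x i)) =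
        b ^ 2 * coshBarrier d T lam b (t, x) := by rw [coshBarrier]; ring
    rw [hbar] at hsum
    have heq : ∀ η : ℝ → Rd d → ℝ, IsViscousHJSolution d T ε (fun _ => 0) g η →
        Real.exp (-ε⁻¹ * η t x) * (-ε⁻¹ * deriv (fun s => η s x) t) + ε / 2 *
          (Real.exp (-ε⁻¹ * η t x) *
            (ε⁻¹ ^ 2 * ‖gradient (η t) x‖ ^ 2 - ε⁻¹ * Laplacian.laplacian (η t) x)) = 0 := by
      intro η hη
      have h := hη.equation t ht x
      have h' : deriv (fun s => η s x) t =
          1 / 2 * ‖gradient (η t) x‖ ^ 2 - ε / 2 * Laplacian.laplacian (η t) x := by linarith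
      rw [h']
      field_simp
      ring
    have h1 := heq φ hφ
    have h2 := heq ψ hψ
    have hB := coshBarrier_nonneg d T lam b (t, x)
    have hdt : 0 < δ / t ^ 2 := div_pos hδ (pow_pos ht.1 2)
    have hs2 := mul_nonneg (half_pos hε).le (sub_nonneg.2 hsum)
    have hδB := mul_nonneg hδ.le hB
    have hexp : -lam * coshBarrier d T lam b (t, x) = -(ε / 2 * b ^ 2 *
      coshBarrier d T lam b (t, x)) - coshBarrier d T lam b (t, x) := by rw [hlam]; ring
    rw [hexp] at hcrit
    linarith

theorem IsViscousHJSolution.unique {d : ℕ} {T : ℝ} (hT : 0 < T) {ε : ℝ} (hε : 0 < ε)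
    {g : Rd d → ℝ} {φ ψ : ℝ → Rd d → ℝ} (hφ : IsViscousHJSolution d T ε (fun _ => 0) g φ)
    (hψ : IsViscousHJSolution d T ε (fun _ => 0) g ψ) :
    ∀ t ∈ Icc 0 T, ∀ x, φ t x = ψ t x :=
  fun t ht x => le_antisymm (hφ.le hT hε hψ t ht x) (hψ.le hT hε hφ t ht x)

/-! ### Gaussian Laplace transforms -/

open MeasureTheory in
theorem integrable_exp_mul_norm_sub_mul_norm_sq (V : Type*) [NormedAddCommGroup V]
    [InnerProductSpace ℝ V] [FiniteDimensional ℝ V] [MeasurableSpace V] [BorelSpace V] (b : ℝ)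
    {c : ℝ} (hc : 0 < c) : Integrable (fun y : V => Real.exp (b * ‖y‖ - c * ‖y‖ ^ 2)) := by
  have h1 : Integrable (fun y : V => Real.exp (-(c / 2) * ‖y‖ ^ 2)) :=
    Integrable.of_integral_ne_zero (by
      rw [GaussianFourier.integral_rexp_neg_mul_sq_norm (by positivity)]; positivity)
  refine (h1.const_mul (Real.exp (b ^ 2 / (2 * c)))).mono'
    (by fun_prop : Continuous _).aestronglyMeasurable (Eventually.of_forall fun y => ?_)
  rw [Real.norm_of_nonneg (Real.exp_pos _).le, ← Real.exp_add, Real.exp_le_exp]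
  have h2 : 0 ≤ (c * ‖y‖ - b) ^ 2 / (2 * c) := by positivity
  have h3 : (c * ‖y‖ - b) ^ 2 / (2 * c) = c / 2 * ‖y‖ ^ 2 - b * ‖y‖ + b ^ 2 / (2 * c) := by
    field_simp; ring
  linarith

/-- Continuous functions of at most exponential growth. Polynomial factors are absorbed by the
exponential, so the class is stable under multiplication by the moments `⟪y, v⟫` and `|y|²`. -/
def HasExpGrowth {k : ℕ} {E : Type} [NormedAddCommGroup E] (h : Rd k → E) : Prop :=
  Continuous h ∧ ∃ C a : ℝ, ∀ y, ‖h y‖ ≤ C * Real.exp (a * ‖y‖)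

/-- The linear form `(q, p) ↦ ⟪p, y⟫ - q |y|²`. -/
noncomputable def gaussExponent {k : ℕ} (y : Rd k) : ℝ × Rd k →L[ℝ] ℝ :=
  (innerSL ℝ y).comp (ContinuousLinearMap.snd ℝ ℝ (Rd k)) -
    ‖y‖ ^ 2 • ContinuousLinearMap.fst ℝ ℝ (Rd k)

theorem gaussExponent_apply {k : ℕ} (y : Rd k) (z : ℝ × Rd k) :
    gaussExponent y z = inner ℝ y z.2 - ‖y‖ ^ 2 * z.1 := rfl

theorem continuous_gaussExponent (k : ℕ) :
    Continuous (gaussExponent : Rd k → ℝ × Rd k →L[ℝ] ℝ) := by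
  unfold gaussExponent
  exact (((innerSL ℝ : Rd k →L[ℝ] Rd k →L[ℝ] ℝ).continuous).clm_comp continuous_const).sub
    ((continuous_norm.pow 2).smul continuous_const)

theorem norm_gaussExponent_le {k : ℕ} (y : Rd k) : ‖gaussExponent y‖ ≤ 3 * Real.exp ‖y‖ := by
  have h0 := norm_nonneg y
  have hexp := Real.quadratic_le_exp_of_nonneg h0
  have hle : ‖gaussExponent y‖ ≤ ‖y‖ + ‖y‖ ^ 2 := by
    refine ContinuousLinearMap.opNorm_le_bound _ (by positivity) fun z => ?_
    rw [gaussExponent_apply, add_mul]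
    refine (norm_sub_le _ _).trans (add_le_add ?_ ?_)
    · exact (norm_inner_le_norm _ _).trans (mul_le_mul_of_nonneg_left (norm_snd_le z) h0)
    · rw [norm_mul, Real.norm_of_nonneg (by positivity)]
      exact mul_le_mul_of_nonneg_left (norm_fst_le z) (by positivity)
  nlinarith

/-- The Laplace-type transform `(q, p) ↦ ∫ e^{⟪p,y⟫ - q|y|²} h(y) dy`. -/
noncomputable def gaussLaplace {k : ℕ} {E : Type} [NormedAddCommGroup E] [NormedSpace ℝ E]
    (h : Rd k → E) (z : ℝ × Rd k) : E :=
  ∫ y : Rd k, Real.exp (gaussExponent y z) • h y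

section gaussLaplace

variable {k : ℕ} {E : Type} [NormedAddCommGroup E] [NormedSpace ℝ E] {h : Rd k → E}

theorem HasExpGrowth.smulRight (hh : HasExpGrowth h) :
    HasExpGrowth fun y => (gaussExponent y).smulRight (h y) := by
  obtain ⟨hc, C, a, hb⟩ := hh
  refine ⟨?_, 3 * C, a + 1, fun y => ?_⟩
  · exact ((ContinuousLinearMap.smulRightL ℝ (ℝ × Rd k) E).continuous.comp
      (continuous_gaussExponent k)).clm_apply hc
  · rw [ContinuousLinearMap.norm_smulRight_apply]
    calc ‖gaussExponent y‖ * ‖h y‖ ≤ (3 * Real.exp ‖y‖) * (C * Real.exp (a * ‖y‖)) :=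
          mul_le_mul (norm_gaussExponent_le y) (hb y) (norm_nonneg _) (by positivity)
      _ = 3 * C * Real.exp ((a + 1) * ‖y‖) := by
          rw [show (a + 1) * ‖y‖ = ‖y‖ + a * ‖y‖ by ring, Real.exp_add]; ring

theorem HasExpGrowth.mul {f g : Rd k → ℝ} (hf : HasExpGrowth f) (hg : HasExpGrowth g) :
    HasExpGrowth fun y => f y * g y := by
  obtain ⟨hc, C, a, hb⟩ := hf
  obtain ⟨hc', C', a', hb'⟩ := hg
  refine ⟨hc.mul hc', C * C', a + a', fun y => ?_⟩
  rw [norm_mul]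
  calc ‖f y‖ * ‖g y‖ ≤ (C * Real.exp (a * ‖y‖)) * (C' * Real.exp (a' * ‖y‖)) :=
        mul_le_mul (hb y) (hb' y) (norm_nonneg _) ((norm_nonneg _).trans (hb y))
    _ = _ := by rw [add_mul, Real.exp_add]; ring

theorem hasExpGrowth_exp_mul_norm (k : ℕ) (a : ℝ) :
    HasExpGrowth fun y : Rd k => Real.exp (a * ‖y‖) :=
  ⟨by fun_prop, 1, a, fun y => by rw [Real.norm_of_nonneg (Real.exp_pos _).le, one_mul]⟩

theorem hasExpGrowth_inner (v : Rd k) : HasExpGrowth fun y : Rd k => inner ℝ y v := by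
  refine ⟨by fun_prop, ‖v‖, 1, fun y => ?_⟩
  have h1 := Real.add_one_le_exp ‖y‖
  rw [one_mul, mul_comm]
  exact (norm_inner_le_norm _ _).trans (mul_le_mul_of_nonneg_right (by linarith) (norm_nonneg _))

theorem hasExpGrowth_norm_sq (k : ℕ) : HasExpGrowth fun y : Rd k => ‖y‖ ^ 2 := by
  refine ⟨by fun_prop, 2, 1, fun y => ?_⟩
  have h1 := Real.quadratic_le_exp_of_nonneg (norm_nonneg y)
  rw [Real.norm_of_nonneg (by positivity), one_mul]
  nlinarith [norm_nonneg y]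

theorem gaussExponent_le {y : Rd k} {z : ℝ × Rd k} {b c : ℝ} (hb : ‖z.2‖ ≤ b) (hc : c ≤ z.1) :
    gaussExponent y z ≤ b * ‖y‖ - c * ‖y‖ ^ 2 := by
  rw [gaussExponent_apply]
  have h1 := real_inner_le_norm y z.2
  have h2 := mul_le_mul_of_nonneg_left hb (norm_nonneg y)
  have h3 := mul_le_mul_of_nonneg_left hc (sq_nonneg ‖y‖)
  linarith

open MeasureTheory

theorem HasExpGrowth.norm_exp_smul_le {C a : ℝ} (hb : ∀ y, ‖h y‖ ≤ C * Real.exp (a * ‖y‖))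
    {y : Rd k} {z : ℝ × Rd k} {b c : ℝ} (hzb : ‖z.2‖ ≤ b) (hzc : c ≤ z.1) :
    ‖Real.exp (gaussExponent y z) • h y‖ ≤ C * Real.exp ((b + a) * ‖y‖ - c * ‖y‖ ^ 2) := by
  rw [norm_smul, Real.norm_of_nonneg (Real.exp_pos _).le]
  calc _ ≤ Real.exp (b * ‖y‖ - c * ‖y‖ ^ 2) * (C * Real.exp (a * ‖y‖)) :=
        mul_le_mul (Real.exp_le_exp.2 (gaussExponent_le hzb hzc)) (hb y) (norm_nonneg _)
          (Real.exp_pos _).le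
    _ = _ := by
        rw [show (b + a) * ‖y‖ - c * ‖y‖ ^ 2 = b * ‖y‖ - c * ‖y‖ ^ 2 + a * ‖y‖ by ring,
          Real.exp_add]
        ring

theorem HasExpGrowth.continuous_exp_smul (hh : HasExpGrowth h) (z : ℝ × Rd k) :
    Continuous fun y => Real.exp (gaussExponent y z) • h y :=
  (Real.continuous_exp.comp ((continuous_gaussExponent k).clm_apply continuous_const)).smul hh.1

theorem HasExpGrowth.integrable (hh : HasExpGrowth h) {z : ℝ × Rd k} (hz : 0 < z.1) :
    Integrable fun y => Real.exp (gaussExponent y z) • h y := by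
  have hcont := hh.continuous_exp_smul z
  obtain ⟨hc, C, a, hb⟩ := hh
  exact ((integrable_exp_mul_norm_sub_mul_norm_sq (Rd k) (‖z.2‖ + a) hz).const_mul C).mono'
    hcont.aestronglyMeasurable
    (Eventually.of_forall fun y => norm_exp_smul_le hb le_rfl le_rfl)

theorem hasFDerivAt_exp_gaussExponent_smul (y : Rd k) (c : E) (z : ℝ × Rd k) :
    HasFDerivAt (fun z => Real.exp (gaussExponent y z) • c)
      (Real.exp (gaussExponent y z) • (gaussExponent y).smulRight c) z := by
  have := ((gaussExponent y).hasFDerivAt (x := z)).exp.smul_const c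
  refine this.congr_fderiv (ContinuousLinearMap.ext fun w => ?_)
  simp [smul_smul]

theorem HasExpGrowth.hasFDerivAt_gaussLaplace (hh : HasExpGrowth h) {z : ℝ × Rd k}
    (hz : 0 < z.1) : HasFDerivAt (gaussLaplace h)
      (gaussLaplace (fun y => (gaussExponent y).smulRight (h y)) z) z := by
  have hh' := hh.smulRight
  have hcont' := hh'.continuous_exp_smul z
  obtain ⟨-, C, a, hb⟩ := hh'
  have hnhds : {z' : ℝ × Rd k | ‖z'.2‖ ≤ ‖z.2‖ + 1 ∧ z.1 / 2 ≤ z'.1} ∈ 𝓝 z := by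
    have h1 : ∀ᶠ z' in 𝓝 z, ‖z'.2‖ < ‖z.2‖ + 1 :=
      (continuous_snd.norm.tendsto z).eventually_lt_const (by linarith)
    have h2 : ∀ᶠ z' in 𝓝 z, z.1 / 2 < z'.1 :=
      (continuous_fst.tendsto z).eventually_const_lt (by linarith)
    filter_upwards [h1, h2] with z' h1 h2 using ⟨h1.le, h2.le⟩
  have h1 : ∀ y : Rd k, ∀ z' ∈ {z' : ℝ × Rd k | ‖z'.2‖ ≤ ‖z.2‖ + 1 ∧ z.1 / 2 ≤ z'.1},
      ‖Real.exp (gaussExponent y z') • (gaussExponent y).smulRight (h y)‖ ≤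
        C * Real.exp ((‖z.2‖ + 1 + a) * ‖y‖ - z.1 / 2 * ‖y‖ ^ 2) := fun y z' hz' =>
    HasExpGrowth.norm_exp_smul_le (h := fun y => (gaussExponent y).smulRight (h y)) hb hz'.1 hz'.2
  have h2 := (integrable_exp_mul_norm_sub_mul_norm_sq (Rd k) (‖z.2‖ + 1 + a)
    (half_pos hz)).const_mul C
  have h3 := hh.integrable hz
  have h4 : ∀ᶠ z' in 𝓝 z, AEStronglyMeasurable
      (fun y => Real.exp (gaussExponent y z') • h y) volume :=
    Eventually.of_forall fun z' => (hh.continuous_exp_smul z').aestronglyMeasurable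
  have h5 := hcont'.aestronglyMeasurable (μ := volume)
  exact hasFDerivAt_integral_of_dominated_of_fderiv_le hnhds h4 h3 h5
    (Eventually.of_forall h1) h2
    (Eventually.of_forall fun y z' _ => hasFDerivAt_exp_gaussExponent_smul y (h y) z')

theorem isOpen_fst_pos (k : ℕ) : IsOpen {z : ℝ × Rd k | 0 < z.1} :=
  isOpen_lt continuous_const continuous_fst

end gaussLaplace

/-- `gaussLaplace h` is smooth on `q > 0`. The induction runs over all target spaces, because the
derivative is the transform of the operator-valued function `y ↦ h(y) ⊗ (y, -|y|²)`. -/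
theorem HasExpGrowth.contDiffOn_gaussLaplace_nat {k : ℕ} (n : ℕ) :
    ∀ {E : Type} [NormedAddCommGroup E] [NormedSpace ℝ E] {h : Rd k → E}, HasExpGrowth h →
      ContDiffOn ℝ n (gaussLaplace h) {z | 0 < z.1} := by
  induction n with
  | zero =>
    intro E _ _ h hh
    exact contDiffOn_zero.2 fun z hz =>
      (hh.hasFDerivAt_gaussLaplace hz).continuousAt.continuousWithinAt
  | succ n ih =>
    intro E _ _ h hh
    push_cast
    rw [contDiffOn_succ_iff_fderiv_of_isOpen (isOpen_fst_pos k)]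
    refine ⟨fun z hz => (hh.hasFDerivAt_gaussLaplace hz).differentiableAt.differentiableWithinAt,
      by simp, ?_⟩
    exact (ih hh.smulRight).congr fun z hz => (hh.hasFDerivAt_gaussLaplace hz).fderiv

open MeasureTheory in
/-- The derivatives of `gaussLaplace h` bring down the factors `⟪y, v⟫` and `-|y|²`. -/
theorem HasExpGrowth.gaussLaplace_smulRight_apply {k : ℕ} {h : Rd k → ℝ} (hh : HasExpGrowth h)
    {z : ℝ × Rd k} (hz : 0 < z.1) (w : ℝ × Rd k) :
    gaussLaplace (fun y => (gaussExponent y).smulRight (h y)) z w =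
      gaussLaplace (fun y => inner ℝ y w.2 * h y) z -
        w.1 * gaussLaplace (fun y => ‖y‖ ^ 2 * h y) z := by
  have h1 := ((hasExpGrowth_inner w.2).mul hh).integrable hz
  have h2 := ((hasExpGrowth_norm_sq k).mul hh).integrable hz
  unfold gaussLaplace
  rw [ContinuousLinearMap.integral_apply (hh.smulRight.integrable hz), ← integral_const_mul,
    ← integral_sub h1 (h2.const_mul _)]
  refine integral_congr_ae (Eventually.of_forall fun y => ?_)
  simp only [smul_apply, ContinuousLinearMap.smulRight_apply,
    gaussExponent_apply, smul_eq_mul]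
  ring

theorem HasExpGrowth.hasTwoDerivsAtZero_gaussLaplace {k : ℕ} {h : Rd k → ℝ} (hh : HasExpGrowth h)
    {q : ℝ} (hq : 0 < q) (p v : Rd k) :
    HasTwoDerivsAtZero (fun r : ℝ => gaussLaplace h (q, p + r • v))
      (gaussLaplace (fun y => inner ℝ y v * h y) (q, p))
      (gaussLaplace (fun y => inner ℝ y v * (inner ℝ y v * h y)) (q, p)) := by
  have key : ∀ {g : Rd k → ℝ}, HasExpGrowth g → ∀ r : ℝ,
      HasDerivAt (fun r : ℝ => gaussLaplace g (q, p + r • v))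
        (gaussLaplace (fun y => inner ℝ y v * g y) (q, p + r • v)) r := by
    intro g hg r
    have h1 : HasDerivAt (fun r : ℝ => (q, p + r • v)) ((0 : ℝ), v) r := by
      have : HasDerivAt (fun r : ℝ => p + r • v) v r := by
        simpa using ((hasDerivAt_id r).smul_const v).const_add p
      exact (hasDerivAt_const r q).prodMk this
    have h2 := (hg.hasFDerivAt_gaussLaplace (z := (q, p + r • v)) hq).comp_hasDerivAt r h1
    refine h2.congr_deriv ?_
    rw [hg.gaussLaplace_smulRight_apply (z := (q, p + r • v)) hq]
    simp
  refine ⟨fun r => gaussLaplace (fun y => inner ℝ y v * h y) (q, p + r • v), key hh, by simp, ?_⟩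
  simpa using key ((hasExpGrowth_inner v).mul hh) 0

/-! ### The heat flow started from an exponential of the norm -/

/-- The Gaussian average of `e^{a|·|}` around `ξ` with variance `s`, i.e. the value at time `s` of
the heat flow `∂_s = Δ/2` on `ℝ^k` started from `e^{a|·|}`. For `s ≤ 0` it is `e^{a|ξ|}`. -/
noncomputable def gaussMean {k : ℕ} (a s : ℝ) (ξ : Rd k) : ℝ :=
  (2 * Real.pi) ^ (-(k : ℝ) / 2) * ∫ z : Rd k, Real.exp (a * ‖ξ + √s • z‖ - 1 / 2 * ‖z‖ ^ 2)

open MeasureTheory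

theorem integral_exp_neg_half_norm_sq (k : ℕ) :
    (2 * Real.pi) ^ (-(k : ℝ) / 2) * ∫ z : Rd k, Real.exp (-(1 / 2) * ‖z‖ ^ 2) = 1 := by
  rw [GaussianFourier.integral_rexp_neg_mul_sq_norm (by norm_num), finrank_euclideanSpace,
    Fintype.card_fin, show Real.pi / (1 / 2) = 2 * Real.pi by ring,
    ← Real.rpow_add (by positivity)]
  rw [show -(k : ℝ) / 2 + k / 2 = 0 by ring, Real.rpow_zero]

theorem exp_gaussMean_integrand_le {k : ℕ} {a σ b S : ℝ} (ha : 0 ≤ a) {ξ : Rd k} (hξ : ‖ξ‖ ≤ b)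
    (h0 : 0 ≤ σ) (hσ : σ ≤ S) (z : Rd k) :
    Real.exp (a * ‖ξ + σ • z‖ - 1 / 2 * ‖z‖ ^ 2) ≤
      Real.exp (a * b) * Real.exp (a * S * ‖z‖ - 1 / 2 * ‖z‖ ^ 2) := by
  rw [← Real.exp_add, Real.exp_le_exp]
  have h1 : ‖ξ + σ • z‖ ≤ b + S * ‖z‖ := by
    refine (norm_add_le _ _).trans (add_le_add hξ ?_)
    rw [norm_smul, Real.norm_of_nonneg h0]
    exact mul_le_mul_of_nonneg_right hσ (norm_nonneg _)
  have := mul_le_mul_of_nonneg_left h1 ha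
  linarith

theorem integrable_gaussMean {k : ℕ} {a : ℝ} (ha : 0 ≤ a) (s : ℝ) (ξ : Rd k) :
    Integrable fun z : Rd k => Real.exp (a * ‖ξ + √s • z‖ - 1 / 2 * ‖z‖ ^ 2) := by
  refine ((integrable_exp_mul_norm_sub_mul_norm_sq (Rd k) (a * √s) one_half_pos).const_mul
    (Real.exp (a * ‖ξ‖))).mono' (by fun_prop : Continuous _).aestronglyMeasurable
    (Eventually.of_forall fun z => ?_)
  rw [Real.norm_of_nonneg (Real.exp_pos _).le]
  exact exp_gaussMean_integrand_le ha le_rfl (Real.sqrt_nonneg _) le_rfl z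

theorem continuous_gaussMean {k : ℕ} {a : ℝ} (ha : 0 ≤ a) :
    Continuous fun p : ℝ × Rd k => gaussMean a p.1 p.2 := by
  refine continuous_const.mul (continuous_iff_continuousAt.2 fun p => ?_)
  refine continuousAt_of_dominated (bound := fun z => Real.exp (a * (‖p.2‖ + 1)) *
      Real.exp (a * (√p.1 + 1) * ‖z‖ - 1 / 2 * ‖z‖ ^ 2)) (Eventually.of_forall fun q =>
      (by fun_prop : Continuous _).aestronglyMeasurable) ?_
    ((integrable_exp_mul_norm_sub_mul_norm_sq (Rd k) _ one_half_pos).const_mul _)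
    (Eventually.of_forall fun z => (by fun_prop : Continuous _).continuousAt)
  have h1 : ∀ᶠ q : ℝ × Rd k in 𝓝 p, ‖q.2‖ < ‖p.2‖ + 1 :=
    (continuous_snd.norm.tendsto p).eventually_lt_const (by linarith)
  have h2 : ∀ᶠ q : ℝ × Rd k in 𝓝 p, √q.1 < √p.1 + 1 :=
    ((Real.continuous_sqrt.comp continuous_fst).tendsto p).eventually_lt_const (by simp)
  filter_upwards [h1, h2] with q h1 h2
  refine Eventually.of_forall fun z => ?_
  rw [Real.norm_of_nonneg (Real.exp_pos _).le]
  exact exp_gaussMean_integrand_le ha h1.le (Real.sqrt_nonneg _) h2.le z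

theorem one_le_gaussMean {k : ℕ} {a : ℝ} (ha : 0 ≤ a) (s : ℝ) (ξ : Rd k) : 1 ≤ gaussMean a s ξ := by
  refine (integral_exp_neg_half_norm_sq k).symm.le.trans ?_
  refine mul_le_mul_of_nonneg_left (integral_mono ?_ (integrable_gaussMean ha s ξ) fun z => ?_)
    (by positivity)
  · simpa using integrable_exp_mul_norm_sub_mul_norm_sq (Rd k) 0 one_half_pos
  · refine Real.exp_le_exp.2 ?_
    have : 0 ≤ a * ‖ξ + √s • z‖ := by positivity
    linarith

theorem gaussMean_pos {k : ℕ} {a : ℝ} (ha : 0 ≤ a) (s : ℝ) (ξ : Rd k) : 0 < gaussMean a s ξ :=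
  one_pos.trans_le (one_le_gaussMean ha s ξ)

theorem gaussMean_zero {k : ℕ} (a : ℝ) (ξ : Rd k) : gaussMean a 0 ξ = Real.exp (a * ‖ξ‖) := by
  rw [gaussMean]
  have : ∀ z : Rd k, Real.exp (a * ‖ξ + √0 • z‖ - 1 / 2 * ‖z‖ ^ 2) =
      Real.exp (a * ‖ξ‖) * Real.exp (-(1 / 2) * ‖z‖ ^ 2) := fun z => by
    rw [← Real.exp_add, Real.sqrt_zero, zero_smul, add_zero]; ring_nf
  simp_rw [this]
  rw [integral_const_mul, mul_left_comm, integral_exp_neg_half_norm_sq, mul_one]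

theorem gaussMean_le {k : ℕ} {a : ℝ} (ha : 0 ≤ a) {s S : ℝ} (hs : s ≤ S) (ξ : Rd k) :
    gaussMean a s ξ ≤ Real.exp (a * ‖ξ‖) * gaussMean a S (0 : Rd k) := by
  rw [gaussMean, gaussMean, mul_left_comm (Real.exp _),
    ← integral_const_mul (Real.exp (a * ‖ξ‖))]
  refine mul_le_mul_of_nonneg_left (integral_mono (integrable_gaussMean ha s ξ)
    ((integrable_gaussMean ha S 0).const_mul _) fun z => ?_) (by positivity)
  refine (exp_gaussMean_integrand_le ha le_rfl (Real.sqrt_nonneg _) (Real.sqrt_le_sqrt hs)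
    z).trans_eq ?_
  rw [zero_add, norm_smul, Real.norm_of_nonneg (Real.sqrt_nonneg _), mul_assoc]

/-- Expanding the square in the heat kernel. -/
theorem gaussMean_eq_gaussLaplace {k : ℕ} (a : ℝ) {s : ℝ} (hs : 0 < s) (ξ : Rd k) :
    gaussMean a s ξ = (2 * Real.pi) ^ (-(k : ℝ) / 2) * (s ^ (-(k : ℝ) / 2) *
      Real.exp (-‖ξ‖ ^ 2 * (2 * s)⁻¹) *
      gaussLaplace (fun y : Rd k => Real.exp (a * ‖y‖)) ((2 * s)⁻¹, s⁻¹ • ξ)) := by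
  rw [gaussMean]
  congr 1
  have h1 : ∀ z : Rd k, Real.exp (a * ‖ξ + √s • z‖ - 1 / 2 * ‖z‖ ^ 2) =
      (fun w : Rd k => Real.exp (a * ‖ξ + w‖ - (2 * s)⁻¹ * ‖w‖ ^ 2)) (√s • z) := by
    intro z
    simp only [norm_smul, mul_pow, Real.norm_of_nonneg (Real.sqrt_nonneg s), Real.sq_sqrt hs.le]
    congr 2
    field_simp
  refine (integral_congr_ae (Eventually.of_forall h1)).trans
    ((Measure.integral_comp_smul volume
      (fun w : Rd k => Real.exp (a * ‖ξ + w‖ - (2 * s)⁻¹ * ‖w‖ ^ 2)) √s).trans ?_)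
  have h2 : |(√s ^ Module.finrank ℝ (Rd k))⁻¹| = s ^ (-(k : ℝ) / 2) := by
    rw [finrank_euclideanSpace, Fintype.card_fin, abs_of_nonneg (by positivity),
      Real.sqrt_eq_rpow, ← Real.rpow_natCast, ← Real.rpow_mul hs.le, ← Real.rpow_neg hs.le]
    congr 1; ring
  rw [h2, smul_eq_mul, mul_assoc]
  congr 1
  rw [← integral_add_left_eq_self (μ := (volume : Measure (Rd k))) _ (-ξ : Rd k), gaussLaplace,
    ← integral_const_mul]
  refine integral_congr_ae (Eventually.of_forall fun y => ?_)
  simp only [smul_eq_mul]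
  rw [← Real.exp_add, ← Real.exp_add, gaussExponent_apply, add_neg_cancel_left, neg_add_eq_sub,
    norm_sub_sq_real, real_inner_smul_right]
  congr 1
  field_simp
  ring

theorem contDiffAt_gaussMean {k : ℕ} (a : ℝ) {p : ℝ × Rd k} (hp : 0 < p.1) (n : ℕ) :
    ContDiffAt ℝ n (fun p : ℝ × Rd k => gaussMean a p.1 p.2) p := by
  have heq : (fun p : ℝ × Rd k => gaussMean a p.1 p.2) =ᶠ[𝓝 p] fun p =>
      (2 * Real.pi) ^ (-(k : ℝ) / 2) * (p.1 ^ (-(k : ℝ) / 2) *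
      Real.exp (-‖p.2‖ ^ 2 * (2 * p.1)⁻¹) *
      gaussLaplace (fun y : Rd k => Real.exp (a * ‖y‖)) ((2 * p.1)⁻¹, p.1⁻¹ • p.2)) := by
    filter_upwards [(isOpen_fst_pos k).mem_nhds hp] with q hq
      using gaussMean_eq_gaussLaplace a hq q.2
  refine ContDiffAt.congr_of_eventuallyEq ?_ heq
  have hi : ContDiffAt ℝ n (fun p : ℝ × Rd k => (2 * p.1)⁻¹) p :=
    (contDiffAt_const.mul contDiffAt_fst).inv (by positivity)
  have hF : ContDiffAt ℝ n (gaussLaplace (fun y : Rd k => Real.exp (a * ‖y‖)))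
      ((2 * p.1)⁻¹, p.1⁻¹ • p.2) :=
    ((hasExpGrowth_exp_mul_norm k a).contDiffOn_gaussLaplace_nat n).contDiffAt
      ((isOpen_fst_pos k).mem_nhds (show 0 < (2 * p.1)⁻¹ by positivity))
  refine contDiffAt_const.mul (((contDiffAt_fst.rpow_const_of_ne hp.ne').mul
    (((contDiffAt_snd.norm_sq ℝ).neg.mul hi).exp)).mul ?_)
  exact ContDiffAt.comp (g := gaussLaplace (fun y : Rd k => Real.exp (a * ‖y‖))) p hF
    (hi.prodMk ((contDiffAt_fst.inv hp.ne').smul contDiffAt_snd))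

/-- Time derivative of the heat flow, in terms of moments of the weight. -/
theorem hasDerivAt_gaussMean {k : ℕ} (a : ℝ) {s : ℝ} (hs : 0 < s) (ξ : Rd k) :
    HasDerivAt (fun s => gaussMean a s ξ)
      ((2 * Real.pi) ^ (-(k : ℝ) / 2) * (s ^ (-(k : ℝ) / 2) * Real.exp (-‖ξ‖ ^ 2 * (2 * s)⁻¹)) *
        ((-(k : ℝ) / (2 * s) + ‖ξ‖ ^ 2 / (2 * s ^ 2)) *
            gaussLaplace (fun y : Rd k => Real.exp (a * ‖y‖)) ((2 * s)⁻¹, s⁻¹ • ξ) +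
          gaussLaplace (fun y : Rd k => ‖y‖ ^ 2 * Real.exp (a * ‖y‖)) ((2 * s)⁻¹, s⁻¹ • ξ) /
            (2 * s ^ 2) -
          gaussLaplace (fun y : Rd k => inner ℝ y ξ * Real.exp (a * ‖y‖)) ((2 * s)⁻¹, s⁻¹ • ξ) /
            s ^ 2)) s := by
  have heq : (fun s => gaussMean a s ξ) =ᶠ[𝓝 s] fun s =>
      (2 * Real.pi) ^ (-(k : ℝ) / 2) * (s ^ (-(k : ℝ) / 2) *
      Real.exp (-‖ξ‖ ^ 2 * (2 * s)⁻¹) *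
      gaussLaplace (fun y : Rd k => Real.exp (a * ‖y‖)) ((2 * s)⁻¹, s⁻¹ • ξ)) := by
    filter_upwards [lt_mem_nhds hs] with r hr using gaussMean_eq_gaussLaplace a hr ξ
  refine HasDerivAt.congr_of_eventuallyEq ?_ heq
  have hh := hasExpGrowth_exp_mul_norm k a
  have hinv : HasDerivAt (fun s : ℝ => (2 * s)⁻¹) (-(2 * s ^ 2)⁻¹) s := by
    refine (((hasDerivAt_id s).const_mul 2).inv (by simpa using hs.ne')).congr_deriv ?_
    simp only [id]; field_simp
  have hinv2 : HasDerivAt (fun s : ℝ => s⁻¹ • ξ) (-(s ^ 2)⁻¹ • ξ) s :=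
    (hasDerivAt_inv hs.ne').smul_const ξ
  have hF := (hh.hasFDerivAt_gaussLaplace (z := ((2 * s)⁻¹, s⁻¹ • ξ))
    (show 0 < (2 * s)⁻¹ by positivity)).comp_hasDerivAt s (hinv.prodMk hinv2)
  rw [hh.gaussLaplace_smulRight_apply (show 0 < ((2 * s)⁻¹, s⁻¹ • ξ).1 by positivity)] at hF
  have hpow : HasDerivAt (fun s : ℝ => s ^ (-(k : ℝ) / 2))
      (-(k : ℝ) / 2 * (s ^ (-(k : ℝ) / 2) / s)) s := by
    have := Real.hasDerivAt_rpow_const (x := s) (p := -(k : ℝ) / 2) (Or.inl hs.ne')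
    rwa [Real.rpow_sub_one hs.ne'] at this
  have hexp := (hinv.const_mul (-‖ξ‖ ^ 2)).exp
  refine (((hpow.mul hexp).mul hF).const_mul _).congr_deriv ?_
  have hlin : gaussLaplace (fun y : Rd k => inner ℝ y (-(s ^ 2)⁻¹ • ξ) * Real.exp (a * ‖y‖))
      ((2 * s)⁻¹, s⁻¹ • ξ) = -(s ^ 2)⁻¹ *
      gaussLaplace (fun y : Rd k => inner ℝ y ξ * Real.exp (a * ‖y‖)) ((2 * s)⁻¹, s⁻¹ • ξ) := by
    unfold gaussLaplace
    rw [← integral_const_mul]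
    refine integral_congr_ae (Eventually.of_forall fun y => ?_)
    simp only [real_inner_smul_right, smul_eq_mul]; ring
  simp only [Function.comp_apply, hlin, Pi.mul_apply]
  field_simp
  ring

/-- Second derivative of the heat flow along a line, in terms of moments of the weight. -/
theorem hasTwoDerivsAtZero_gaussMean {k : ℕ} (a : ℝ) {s : ℝ} (hs : 0 < s) (ξ e : Rd k) :
    ∃ c, HasTwoDerivsAtZero (fun r : ℝ => gaussMean a s (ξ + r • e)) c
      ((2 * Real.pi) ^ (-(k : ℝ) / 2) * (s ^ (-(k : ℝ) / 2) * Real.exp (-‖ξ‖ ^ 2 * (2 * s)⁻¹)) *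
        (((inner ℝ ξ e * inner ℝ ξ e) / s ^ 2 - ‖e‖ ^ 2 / s) *
            gaussLaplace (fun y : Rd k => Real.exp (a * ‖y‖)) ((2 * s)⁻¹, s⁻¹ • ξ) -
          2 * (inner ℝ ξ e *
            gaussLaplace (fun y : Rd k => inner ℝ y e * Real.exp (a * ‖y‖))
              ((2 * s)⁻¹, s⁻¹ • ξ)) / s ^ 2 +
          gaussLaplace (fun y : Rd k => inner ℝ y e * (inner ℝ y e * Real.exp (a * ‖y‖)))
            ((2 * s)⁻¹, s⁻¹ • ξ) / s ^ 2)) := by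
  have hfun : (fun r : ℝ => gaussMean a s (ξ + r • e)) = fun r =>
      ((2 * Real.pi) ^ (-(k : ℝ) / 2) * s ^ (-(k : ℝ) / 2)) *
      (Real.exp (-(2 * s)⁻¹ * (‖ξ‖ ^ 2 + 2 * r * inner ℝ ξ e + r ^ 2 * ‖e‖ ^ 2)) *
      gaussLaplace (fun y : Rd k => Real.exp (a * ‖y‖))
        ((2 * s)⁻¹, s⁻¹ • ξ + r • (s⁻¹ • e))) := by
    funext r
    rw [gaussMean_eq_gaussLaplace a hs, norm_add_sq_real, real_inner_smul_right, norm_smul,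
      mul_pow, Real.norm_eq_abs, sq_abs, smul_add, smul_comm s⁻¹ r e]
    ring_nf
  rw [hfun]
  have hquad : HasTwoDerivsAtZero
      (fun r : ℝ => ‖ξ‖ ^ 2 + 2 * r * inner ℝ ξ e + r ^ 2 * ‖e‖ ^ 2)
      (2 * inner ℝ ξ e) (2 * ‖e‖ ^ 2) := by
    refine ⟨fun r => 2 * inner ℝ ξ e + 2 * r * ‖e‖ ^ 2, fun r => ?_, by simp, ?_⟩
    · have := ((((hasDerivAt_id r).const_mul 2).mul_const (inner ℝ ξ e)).const_add (‖ξ‖ ^ 2)).add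
        (((hasDerivAt_id r).pow 2).mul_const (‖e‖ ^ 2))
      refine this.congr_deriv ?_
      simp
    · have := (((hasDerivAt_id (0 : ℝ)).const_mul 2).mul_const (‖e‖ ^ 2)).const_add
        (2 * inner ℝ ξ e)
      refine this.congr_deriv ?_
      simp
  have hF := (hasExpGrowth_exp_mul_norm k a).hasTwoDerivsAtZero_gaussLaplace
    (show 0 < (2 * s)⁻¹ by positivity) (s⁻¹ • ξ) (s⁻¹ • e)
  have hlin : gaussLaplace (fun y : Rd k => inner ℝ y (s⁻¹ • e) * Real.exp (a * ‖y‖))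
      ((2 * s)⁻¹, s⁻¹ • ξ) = s⁻¹ *
      gaussLaplace (fun y : Rd k => inner ℝ y e * Real.exp (a * ‖y‖)) ((2 * s)⁻¹, s⁻¹ • ξ) := by
    unfold gaussLaplace
    rw [← integral_const_mul]
    refine integral_congr_ae (Eventually.of_forall fun y => ?_)
    simp only [real_inner_smul_right, smul_eq_mul]; ring
  have hlin2 : gaussLaplace (fun y : Rd k => inner ℝ y (s⁻¹ • e) *
        (inner ℝ y (s⁻¹ • e) * Real.exp (a * ‖y‖))) ((2 * s)⁻¹, s⁻¹ • ξ) = s⁻¹ ^ 2 *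
      gaussLaplace (fun y : Rd k => inner ℝ y e * (inner ℝ y e * Real.exp (a * ‖y‖)))
        ((2 * s)⁻¹, s⁻¹ • ξ) := by
    unfold gaussLaplace
    rw [← integral_const_mul]
    refine integral_congr_ae (Eventually.of_forall fun y => ?_)
    simp only [real_inner_smul_right, smul_eq_mul]; ring
  have h := ((hquad.const_mul (-(2 * s)⁻¹)).exp.mul hF).const_mul
    ((2 * Real.pi) ^ (-(k : ℝ) / 2) * s ^ (-(k : ℝ) / 2))
  rw [hlin, hlin2] at h
  refine ⟨_, h.congr_second ?_⟩
  simp only [mul_zero, zero_mul, add_zero, zero_smul, ne_eq, OfNat.ofNat_ne_zero,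
    not_false_eq_true, zero_pow]
  rw [show -‖ξ‖ ^ 2 * (2 * s)⁻¹ = -(2 * s)⁻¹ * ‖ξ‖ ^ 2 by ring]
  field_simp
  ring

/-! ### Existence for the viscous problem -/

/-- Joint regularity in `(t, x)` passes to the spatial derivatives. -/
theorem contDiffAt_iteratedFDeriv_snd {d : ℕ} {φ : ℝ → Rd d → ℝ} (n : ℕ) :
    ∀ (m : ℕ) (p : ℝ × Rd d), ContDiffAt ℝ (m + n : ℕ) (Function.uncurry φ) p →
      ContDiffAt ℝ m (fun p : ℝ × Rd d => iteratedFDeriv ℝ n (φ p.1) p.2) p := by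
  induction n with
  | zero =>
    intro m p h
    simp only [iteratedFDeriv_zero_eq_comp, Function.comp_apply]
    exact (continuousMultilinearCurryFin0 ℝ (Rd d) ℝ).symm.contDiff.contDiffAt.comp p h
  | succ n ih =>
    intro m p h
    simp only [iteratedFDeriv_succ_eq_comp_left, Function.comp_apply]
    refine ContDiffAt.comp p (LinearIsometryEquiv.contDiff _).contDiffAt ?_
    have h1 := ih (m + 1) p (by rwa [show m + 1 + n = m + (n + 1) by ring])
    have h2 : ContDiffAt ℝ ((m + 1 : ℕ) : WithTop ℕ∞)
        (Function.uncurry fun (q : ℝ × Rd d) (y : Rd d) => iteratedFDeriv ℝ n (φ q.1) y)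
        (p, p.2) :=
      ContDiffAt.comp (g := fun p : ℝ × Rd d => iteratedFDeriv ℝ n (φ p.1) p.2)
        (f := fun q : (ℝ × Rd d) × Rd d => (q.1.1, q.2)) (p, p.2) h1
        ((contDiff_fst.comp contDiff_fst).prodMk contDiff_snd).contDiffAt
    exact h2.fderiv contDiffAt_snd (by push_cast; exact le_rfl)

theorem isC12_of_contDiffAt {d : ℕ} {T : ℝ} {φ : ℝ → Rd d → ℝ}
    (h : ∀ t ∈ Ioo (0 : ℝ) T, ∀ x, ContDiffAt ℝ 2 (Function.uncurry φ) (t, x)) : IsC12 d T φ where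
  differentiableAt_time t ht x :=
    DifferentiableAt.comp (g := Function.uncurry φ) (f := fun s => (s, x)) t
      ((h t ht x).differentiableAt two_ne_zero)
      (differentiableAt_id.prodMk (differentiableAt_const x))
  contDiff_space t ht := contDiff_iff_contDiffAt.2 fun x =>
    ContDiffAt.comp (g := Function.uncurry φ) x (h t ht x) (contDiffAt_const.prodMk contDiffAt_id)
  continuousOn_deriv_time := by
    rintro ⟨t, x⟩ ⟨ht, -⟩
    have h1 := (h t ht x).fderiv_right (m := 1) (by norm_num)
    have h2 : ContinuousAt (fun p => fderiv ℝ (Function.uncurry φ) p ((1 : ℝ), (0 : Rd d)))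
      (t, x) := h1.continuousAt.clm_apply continuousAt_const
    refine (h2.congr ?_).continuousWithinAt
    filter_upwards [(h t ht x).eventually (by simp)] with p hp
    have h3 : HasDerivAt (fun s : ℝ => (s, p.2)) ((1 : ℝ), (0 : Rd d)) p.1 :=
      (hasDerivAt_id _).prodMk (hasDerivAt_const _ _)
    exact ((hp.differentiableAt two_ne_zero).hasFDerivAt.comp_hasDerivAt (x := p.1) h3).deriv.symm
  continuousOn_fderiv_space := by
    rintro ⟨t, x⟩ ⟨ht, -⟩
    have h1 : ContDiffAt ℝ 2 (Function.uncurry fun (q : ℝ × Rd d) (y : Rd d) => φ q.1 y)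
        ((t, x), x) :=
      ContDiffAt.comp (g := Function.uncurry φ)
        (f := fun q : (ℝ × Rd d) × Rd d => (q.1.1, q.2)) ((t, x), x) (h t ht x)
        ((contDiff_fst.comp contDiff_fst).prodMk contDiff_snd).contDiffAt
    have h2 : ContDiffAt ℝ 1 (fun p : ℝ × Rd d => fderiv ℝ (φ p.1) p.2) (t, x) :=
      ContDiffAt.fderiv (f := fun (q : ℝ × Rd d) (y : Rd d) => φ q.1 y) (g := Prod.snd)
        h1 contDiffAt_snd (by norm_num)
    exact h2.continuousAt.continuousWithinAt
  continuousOn_hessian_space := by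
    rintro ⟨t, x⟩ ⟨ht, -⟩
    exact (contDiffAt_iteratedFDeriv_snd 2 0 (t, x)
      (by exact_mod_cast h t ht x)).continuousAt.continuousWithinAt

/-- The function `(s, x) ↦ gaussMean a s (L x)` solves the heat equation `∂_s = Δ/2`, because
`L L^* = 1`. -/
theorem sum_second_derivs_gaussMean {d k : ℕ} (h : k ≤ d) (a : ℝ) {s : ℝ} (hs : 0 < s)
    (x : Rd d) : ∃ c W : Fin d → ℝ, ∃ D : ℝ,
      HasDerivAt (fun s => gaussMean a s (restrictFirst h x)) D s ∧
      (∀ i, HasTwoDerivsAtZero (fun r : ℝ => gaussMean a s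
        (restrictFirst h (x + r • EuclideanSpace.basisFun (Fin d) ℝ i))) (c i) (W i)) ∧
      ∑ i, W i = 2 * D := by
  set ξ := restrictFirst h x with hξ
  have hline := fun i : Fin d => hasTwoDerivsAtZero_gaussMean a hs ξ
    (restrictFirst h (EuclideanSpace.basisFun (Fin d) ℝ i))
  choose c hc using hline
  simp only [map_add, map_smul, ← hξ]
  refine ⟨c, _, _, hasDerivAt_gaussMean a hs ξ, hc, ?_⟩
  have hz : 0 < ((2 * s)⁻¹, s⁻¹ • ξ).1 := by positivity
  have hh := hasExpGrowth_exp_mul_norm k a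
  have h1 : ∑ i, inner ℝ ξ (restrictFirst h (EuclideanSpace.basisFun (Fin d) ℝ i)) *
      gaussLaplace (fun y : Rd k =>
        inner ℝ y (restrictFirst h (EuclideanSpace.basisFun (Fin d) ℝ i)) * Real.exp (a * ‖y‖))
        ((2 * s)⁻¹, s⁻¹ • ξ) =
      gaussLaplace (fun y : Rd k => inner ℝ y ξ * Real.exp (a * ‖y‖)) ((2 * s)⁻¹, s⁻¹ • ξ) := by
    unfold gaussLaplace
    simp_rw [← integral_const_mul]
    rw [← integral_finsetSum _ fun i _ =>
      (((hasExpGrowth_inner _).mul hh).integrable hz).const_mul _]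
    refine integral_congr_ae (Eventually.of_forall fun y => ?_)
    simp only [smul_eq_mul]
    rw [← sum_inner_restrictFirst h y ξ, Finset.sum_mul, Finset.mul_sum]
    exact Finset.sum_congr rfl fun i _ => by ring
  have h2 : ∑ i, gaussLaplace (fun y : Rd k =>
        inner ℝ y (restrictFirst h (EuclideanSpace.basisFun (Fin d) ℝ i)) *
        (inner ℝ y (restrictFirst h (EuclideanSpace.basisFun (Fin d) ℝ i)) *
          Real.exp (a * ‖y‖))) ((2 * s)⁻¹, s⁻¹ • ξ) =
      gaussLaplace (fun y : Rd k => ‖y‖ ^ 2 * Real.exp (a * ‖y‖)) ((2 * s)⁻¹, s⁻¹ • ξ) := by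
    unfold gaussLaplace
    rw [← integral_finsetSum _ fun i _ =>
      (((hasExpGrowth_inner _).mul ((hasExpGrowth_inner _).mul hh)).integrable hz)]
    refine integral_congr_ae (Eventually.of_forall fun y => ?_)
    simp only [smul_eq_mul]
    rw [← real_inner_self_eq_norm_sq, ← sum_inner_restrictFirst h y y, Finset.sum_mul,
      Finset.mul_sum]
    exact Finset.sum_congr rfl fun i _ => by ring
  have h3 := sum_inner_restrictFirst h ξ ξ
  rw [real_inner_self_eq_norm_sq] at h3
  rw [← Finset.mul_sum, Finset.sum_add_distrib, Finset.sum_sub_distrib, ← Finset.sum_mul,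
    Finset.sum_sub_distrib, ← Finset.sum_div, ← Finset.sum_div, ← Finset.sum_div,
    ← Finset.sum_div, ← Finset.mul_sum, h1, h2, h3, sum_norm_sq_restrictFirst]
  field_simp
  ring

/-- The Cole–Hopf solution `-ε log E[exp(|P_k (x + √ε B_{T-t})| / ε)]`. -/
noncomputable def coleHopf {d k : ℕ} (h : k ≤ d) (T ε t : ℝ) (x : Rd d) : ℝ :=
  -ε * Real.log (gaussMean ε⁻¹ (ε * (T - t)) (restrictFirst h x))

theorem exp_coleHopf {d k : ℕ} (h : k ≤ d) {ε : ℝ} (hε : 0 < ε) (T t : ℝ) (x : Rd d) :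
    Real.exp (-ε⁻¹ * coleHopf h T ε t x) =
      gaussMean ε⁻¹ (ε * (T - t)) (restrictFirst h x) := by
  have hpos := gaussMean_pos (inv_pos.2 hε).le (ε * (T - t)) (restrictFirst h x)
  rw [coleHopf, show ∀ l : ℝ, -ε⁻¹ * (-ε * l) = l from fun l => by field_simp,
    Real.exp_log hpos]

theorem continuous_gaussMean_restrictFirst {d k : ℕ} (h : k ≤ d) {a : ℝ} (ha : 0 ≤ a) (ε T : ℝ) :
    Continuous fun p : ℝ × Rd d => gaussMean a (ε * (T - p.1)) (restrictFirst h p.2) :=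
  Continuous.comp (g := fun p : ℝ × Rd k => gaussMean a p.1 p.2)
    (f := fun p : ℝ × Rd d => (ε * (T - p.1), restrictFirst h p.2)) (continuous_gaussMean ha)
    ((continuous_const.mul (continuous_const.sub continuous_fst)).prodMk
      ((restrictFirst h).continuous.comp continuous_snd))

theorem isC12_coleHopf {d k : ℕ} (h : k ≤ d) {ε : ℝ} (hε : 0 < ε) (T : ℝ) :
    IsC12 d T (coleHopf h T ε) := by
  refine isC12_of_contDiffAt fun t ht x => ?_
  have h1 : ContDiffAt ℝ (2 : ℕ) (fun p : ℝ × Rd k => gaussMean ε⁻¹ p.1 p.2)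
      (ε * (T - t), restrictFirst h x) :=
    contDiffAt_gaussMean ε⁻¹ (mul_pos hε (sub_pos.2 ht.2)) 2
  have h2 : ContDiffAt ℝ (2 : ℕ) (fun p : ℝ × Rd d => (ε * (T - p.1), restrictFirst h p.2))
      (t, x) :=
    ((contDiff_const.mul (contDiff_const.sub contDiff_fst)).prodMk
      ((restrictFirst h).contDiff.comp contDiff_snd)).contDiffAt
  have h3 := ContDiffAt.comp (g := fun p : ℝ × Rd k => gaussMean ε⁻¹ p.1 p.2)
    (f := fun p : ℝ × Rd d => (ε * (T - p.1), restrictFirst h p.2)) (t, x) h1 h2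
  have h4 := ContDiffAt.log h3 (gaussMean_pos (inv_pos.2 hε).le _ _).ne'
  exact contDiffAt_const.mul h4

theorem isViscousHJSolution_coleHopf {d k : ℕ} (h : k ≤ d) {ε : ℝ} (hε : 0 < ε) {T : ℝ} :
    IsViscousHJSolution d T ε (fun _ => 0) (negNormProj d k) (coleHopf h T ε) := by
  have hi : 0 < ε⁻¹ := inv_pos.2 hε
  have hreg : IsC12 d T (coleHopf h T ε) := isC12_coleHopf h hε T
  refine ⟨?_, ?_, hreg, ?_, ?_⟩
  · exact (continuous_const.mul ((continuous_gaussMean_restrictFirst h hi.le ε T).log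
      fun p => (gaussMean_pos hi.le _ _).ne')).continuousOn
  · set M := Real.log (gaussMean ε⁻¹ (ε * T) (0 : Rd k)) with hM
    have hM0 : 0 ≤ M := Real.log_nonneg (one_le_gaussMean hi.le _ _)
    refine ⟨1 + ε * M, fun t ht x => ?_⟩
    have h0 : 0 ≤ Real.log (gaussMean ε⁻¹ (ε * (T - t)) (restrictFirst h x)) :=
      Real.log_nonneg (one_le_gaussMean hi.le _ _)
    have h1 : Real.log (gaussMean ε⁻¹ (ε * (T - t)) (restrictFirst h x)) ≤
        ε⁻¹ * ‖restrictFirst h x‖ + M := by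
      rw [hM, ← Real.log_exp (ε⁻¹ * ‖restrictFirst h x‖),
        ← Real.log_mul (Real.exp_pos _).ne' (gaussMean_pos hi.le _ _).ne']
      refine Real.log_le_log (gaussMean_pos hi.le _ _) (gaussMean_le hi.le ?_ _)
      exact mul_le_mul_of_nonneg_left (by linarith [ht.1]) hε.le
    rw [coleHopf, abs_mul, abs_neg, abs_of_pos hε, abs_of_nonneg h0]
    have h2 := mul_le_mul_of_nonneg_left h1 hε.le
    rw [mul_add, mul_inv_cancel_left₀ hε.ne'] at h2
    have h3 := norm_restrictFirst_le h x
    have h4 : 0 ≤ ε * M * ‖x‖ := by positivity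
    nlinarith
  · intro t ht x
    have hs : 0 < ε * (T - t) := mul_pos hε (sub_pos.2 ht.2)
    obtain ⟨c, W, D, hD, hW, hsum⟩ := sum_second_derivs_gaussMean h ε⁻¹ hs x
    have hWeq : ∀ i, W i = Real.exp (-ε⁻¹ * coleHopf h T ε t x) *
        (ε⁻¹ ^ 2 * fderiv ℝ (coleHopf h T ε t) x (EuclideanSpace.basisFun (Fin d) ℝ i) ^ 2 -
          ε⁻¹ * iteratedFDeriv ℝ 2 (coleHopf h T ε t) x
            ![EuclideanSpace.basisFun (Fin d) ℝ i, EuclideanSpace.basisFun (Fin d) ℝ i]) := by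
      intro i
      have h1 := (hreg.contDiff_space t ht).hasTwoDerivsAtZero_exp_neg_div ε x
        (EuclideanSpace.basisFun (Fin d) ℝ i)
      simp only [exp_coleHopf h hε] at h1
      rw [exp_coleHopf h hε, ← h1.deriv_deriv, ← (hW i).deriv_deriv]
    simp_rw [hWeq] at hsum
    rw [sum_second_derivs_exp_neg_div, exp_coleHopf h hε] at hsum
    have hpos := gaussMean_pos hi.le (ε * (T - t)) (restrictFirst h x)
    set U := gaussMean ε⁻¹ (ε * (T - t)) (restrictFirst h x) with hU
    have hin : HasDerivAt (fun r => ε * (T - r)) (-ε) t := by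
      simpa using ((hasDerivAt_id t).const_sub T).const_mul ε
    have htime : HasDerivAt (fun r => coleHopf h T ε r x) (-ε * (D * -ε / U)) t :=
      ((HasDerivAt.comp (h := fun r => ε * (T - r)) t hD hin).log hpos.ne').const_mul (-ε)
    rw [htime.deriv]
    have hDeq : D = U * (ε⁻¹ ^ 2 * ‖gradient (coleHopf h T ε t) x‖ ^ 2 -
        ε⁻¹ * Laplacian.laplacian (coleHopf h T ε t) x) / 2 := by linarith
    rw [hDeq]
    field_simp
    ring
  · intro x
    rw [coleHopf, sub_self, mul_zero, gaussMean_zero, Real.log_exp, negNormProj_eq h]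
    field_simp

/-! ### Expansion of the viscous solution at the origin -/

/-- Laplace's method for the radial integral: the mass concentrates at `r ≈ A` on the unit scale. -/
theorem tendsto_radial_integral (n : ℕ) :
    Tendsto (fun A : ℝ => (∫ r in Ioi (0 : ℝ), r ^ n * Real.exp (A * r - 1 / 2 * r ^ 2)) *
      Real.exp (-(A ^ 2 / 2)) / A ^ n) atTop (𝓝 √(2 * Real.pi)) := by
  -- recentre at `A` by the substitution `r = v + A`
  have heq : ∀ A : ℝ, (∫ r in Ioi (0 : ℝ), r ^ n * Real.exp (A * r - 1 / 2 * r ^ 2)) *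
      Real.exp (-(A ^ 2 / 2)) / A ^ n =
      ∫ v : ℝ, (Ioi (-A)).indicator (fun v => ((v + A) / A) ^ n * Real.exp (-(1 / 2) * v ^ 2)) v := by
    intro A
    rw [← integral_indicator measurableSet_Ioi, ← integral_add_right_eq_self _ A,
      ← integral_mul_const, ← integral_div]
    refine integral_congr_ae (Eventually.of_forall fun v => ?_)
    simp only [indicator, mem_Ioi]
    by_cases hv : -A < v
    · rw [if_pos hv, if_pos (by linarith), mul_assoc, ← Real.exp_add, div_pow,
        show A * (v + A) - 1 / 2 * (v + A) ^ 2 + -(A ^ 2 / 2) = -(1 / 2) * v ^ 2 by ring]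
      ring
    · rw [if_neg hv, if_neg (by linarith)]; simp
  simp_rw [heq]
  have hlim : √(2 * Real.pi) = ∫ v : ℝ, Real.exp (-(1 / 2) * v ^ 2) := by
    rw [integral_gaussian]; congr 1; ring
  rw [hlim]
  refine tendsto_integral_filter_of_dominated_convergence
    (fun v => n.factorial * Real.exp 1 * Real.exp (1 * ‖v‖ - 1 / 2 * ‖v‖ ^ 2)) ?_ ?_
    ((integrable_exp_mul_norm_sub_mul_norm_sq ℝ 1 one_half_pos).const_mul _) ?_
  · exact Eventually.of_forall fun A => (Measurable.indicator (by fun_prop)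
      measurableSet_Ioi).aestronglyMeasurable
  · filter_upwards [eventually_ge_atTop (1 : ℝ)] with A hA
    refine Eventually.of_forall fun v => ?_
    have hA0 : 0 < A := one_pos.trans_le hA
    have hexp : Real.exp (1 * ‖v‖ - 1 / 2 * ‖v‖ ^ 2) =
        Real.exp ‖v‖ * Real.exp (-(1 / 2) * v ^ 2) := by
      rw [← Real.exp_add, Real.norm_eq_abs, sq_abs]; ring_nf
    by_cases hv : v ∈ Ioi (-A)
    · rw [indicator_of_mem hv, hexp]
      have hv' : 0 < v + A := by have : -A < v := hv; linarith
      have h1 : (v + A) / A ≤ 1 + ‖v‖ := by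
        rw [div_le_iff₀ hA0, Real.norm_eq_abs]
        nlinarith [le_abs_self v, abs_nonneg v]
      have h2 : ((v + A) / A) ^ n ≤ n.factorial * Real.exp (1 + ‖v‖) := by
        have := Real.pow_div_factorial_le_exp (1 + ‖v‖) (by positivity) n
        rw [div_le_iff₀ (by positivity)] at this
        have := pow_le_pow_left₀ (by positivity) h1 n
        linarith
      rw [Real.exp_add] at h2
      rw [Real.norm_of_nonneg (by positivity)]
      calc _ ≤ (n.factorial * (Real.exp 1 * Real.exp ‖v‖)) * Real.exp (-(1 / 2) * v ^ 2) :=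
            mul_le_mul_of_nonneg_right h2 (Real.exp_pos _).le
        _ = _ := by ring
    · rw [indicator_of_notMem hv, norm_zero]; positivity
  · refine Eventually.of_forall fun v => ?_
    have h1 : Tendsto (fun A : ℝ => ((v + A) / A) ^ n * Real.exp (-(1 / 2) * v ^ 2)) atTop
        (𝓝 (Real.exp (-(1 / 2) * v ^ 2))) := by
      have h2 : Tendsto (fun A : ℝ => v / A + 1) atTop (𝓝 (0 + 1)) :=
        (tendsto_id.const_div_atTop v).add_const 1
      have h3 : Tendsto (fun A : ℝ => (v + A) / A) atTop (𝓝 (0 + 1)) := by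
        refine h2.congr' ?_
        filter_upwards [eventually_gt_atTop (0 : ℝ)] with A hA
        rw [add_div, div_self hA.ne']
      have h4 := (h3.pow n).mul_const (Real.exp (-(1 / 2) * v ^ 2))
      rwa [zero_add, one_pow, one_mul] at h4
    refine h1.congr' ?_
    filter_upwards [eventually_gt_atTop (-v)] with A hA
    rw [indicator_of_mem (show v ∈ Ioi (-A) by simp only [mem_Ioi]; linarith)]

/-- The Gaussian average at the origin in polar coordinates. -/
theorem gaussMean_apply_zero {k : ℕ} (hk : 1 ≤ k) (a s : ℝ) :
    gaussMean a s (0 : Rd k) = (2 * Real.pi) ^ (-(k : ℝ) / 2) * (k *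
      (√Real.pi ^ k / Real.Gamma ((k : ℝ) / 2 + 1)) *
      ∫ r in Ioi (0 : ℝ), r ^ (k - 1) * Real.exp (a * √s * r - 1 / 2 * r ^ 2)) := by
  have : Nonempty (Fin k) := ⟨⟨0, hk⟩⟩
  rw [gaussMean]
  congr 1
  have h1 : ∀ z : Rd k, Real.exp (a * ‖0 + √s • z‖ - 1 / 2 * ‖z‖ ^ 2) =
      (fun r : ℝ => Real.exp (a * √s * r - 1 / 2 * r ^ 2)) ‖z‖ := fun z => by
    simp only [zero_add, norm_smul, Real.norm_of_nonneg (Real.sqrt_nonneg s), mul_assoc]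
  refine (integral_congr_ae (Eventually.of_forall h1)).trans
    ((integral_fun_norm_addHaar volume
      (fun r : ℝ => Real.exp (a * √s * r - 1 / 2 * r ^ 2))).trans ?_)
  have hG : 0 < Real.Gamma ((k : ℝ) / 2 + 1) := Real.Gamma_pos_of_pos (by positivity)
  rw [measureReal_def, EuclideanSpace.volume_ball, finrank_euclideanSpace, Fintype.card_fin,
    ENNReal.ofReal_one, one_pow, one_mul, ENNReal.toReal_ofReal (by positivity)]
  simp only [nsmul_eq_mul, smul_eq_mul, mul_assoc]

/-- The constant of the expansion is `√(2π) (2π)^{-k/2}` times the area of the unit sphere. -/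
theorem expansion_constant_eq (k : ℕ) :
    (k : ℝ) * √Real.pi / ((2 : ℝ) ^ (((k : ℝ) - 1) / 2) * Real.Gamma ((k : ℝ) / 2 + 1)) =
    (2 * Real.pi) ^ (-(k : ℝ) / 2) * (k * (√Real.pi ^ k / Real.Gamma ((k : ℝ) / 2 + 1))) *
      √(2 * Real.pi) := by
  have hG : 0 < Real.Gamma ((k : ℝ) / 2 + 1) := Real.Gamma_pos_of_pos (by positivity)
  have hpi := Real.pi_pos
  have h1 : (2 * Real.pi) ^ (-(k : ℝ) / 2) * √Real.pi ^ k * √(2 * Real.pi) *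
      (2 : ℝ) ^ (((k : ℝ) - 1) / 2) = √Real.pi := by
    rw [Real.mul_rpow (by norm_num) hpi.le, Real.sqrt_mul (by norm_num), Real.sqrt_eq_rpow,
      Real.sqrt_eq_rpow, ← Real.rpow_natCast, ← Real.rpow_mul hpi.le]
    have h2 : (2 : ℝ) ^ (-(k : ℝ) / 2) * 2 ^ (1 / 2 : ℝ) * 2 ^ (((k : ℝ) - 1) / 2) = 1 := by
      rw [← Real.rpow_add two_pos, ← Real.rpow_add two_pos,
        show -(k : ℝ) / 2 + 1 / 2 + ((k : ℝ) - 1) / 2 = 0 by ring, Real.rpow_zero]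
    have h3 : Real.pi ^ (-(k : ℝ) / 2) * Real.pi ^ (1 / 2 * (k : ℝ)) = 1 := by
      rw [← Real.rpow_add hpi, show -(k : ℝ) / 2 + 1 / 2 * k = 0 by ring, Real.rpow_zero]
    calc _ = ((2 : ℝ) ^ (-(k : ℝ) / 2) * 2 ^ (1 / 2 : ℝ) * 2 ^ (((k : ℝ) - 1) / 2)) *
          (Real.pi ^ (-(k : ℝ) / 2) * Real.pi ^ (1 / 2 * (k : ℝ))) * Real.pi ^ (1 / 2 : ℝ) := by
          ring
      _ = _ := by rw [h2, h3]; ring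
  have h4 : (0 : ℝ) < 2 ^ (((k : ℝ) - 1) / 2) := by positivity
  rw [div_eq_iff (by positivity)]
  calc (k : ℝ) * √Real.pi = k * ((2 * Real.pi) ^ (-(k : ℝ) / 2) * √Real.pi ^ k *
        √(2 * Real.pi) * (2 : ℝ) ^ (((k : ℝ) - 1) / 2)) := by rw [h1]
    _ = _ := by field_simp

/-- With `A = √((T-t)/ε)`, the Gaussian average at the origin is `c Q(A) e^{A²/2} A^{k-1}` where
`Q(A) → √(2π)`; the term `A²/2` produces `φ⁰` and the power of `A` the `ε log ε` term. -/
theorem isLittleO_coleHopf_zero {d k : ℕ} (hk : 1 ≤ k) (h : k ≤ d) {T t : ℝ} (ht : t < T) :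
    (fun ε : ℝ => coleHopf h T ε t 0 -
      (negNormProj d k 0 - (T - t) / 2 + ((k : ℝ) - 1) / 2 * (ε * Real.log ε)
        - ((k : ℝ) - 1) / 2 * (ε * Real.log (T - t))
        - ε * Real.log ((k : ℝ) * √Real.pi /
          ((2 : ℝ) ^ (((k : ℝ) - 1) / 2) * Real.Gamma ((k : ℝ) / 2 + 1)))))
      =o[𝓝[>] 0] (fun ε : ℝ => ε) := by
  have hτ : 0 < T - t := sub_pos.2 ht
  set τ := T - t with hτdef
  have hG : 0 < Real.Gamma ((k : ℝ) / 2 + 1) := Real.Gamma_pos_of_pos (by positivity)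
  have hk0 : (0 : ℝ) < k := by exact_mod_cast hk
  obtain ⟨c, hc⟩ : ∃ c : ℝ, c = (2 * Real.pi) ^ (-(k : ℝ) / 2) *
    (k * (√Real.pi ^ k / Real.Gamma ((k : ℝ) / 2 + 1))) := ⟨_, rfl⟩
  have hc0 : 0 < c := by rw [hc]; positivity
  set J : ℝ → ℝ := fun A => ∫ r in Ioi (0 : ℝ), r ^ (k - 1) * Real.exp (A * r - 1 / 2 * r ^ 2)
    with hJ
  set Q : ℝ → ℝ := fun A => J A * Real.exp (-(A ^ 2 / 2)) / A ^ (k - 1) with hQ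
  have hs2 : 0 < √(2 * Real.pi) := Real.sqrt_pos.2 (by positivity)
  have hA : Tendsto (fun ε : ℝ => √(τ / ε)) (𝓝[>] 0) atTop :=
    Real.tendsto_sqrt_atTop.comp ((tendsto_inv_nhdsGT_zero.const_mul_atTop hτ).congr
      fun ε => (div_eq_mul_inv τ ε).symm)
  have hQlim : Tendsto (fun ε : ℝ => Q √(τ / ε)) (𝓝[>] 0) (𝓝 √(2 * Real.pi)) :=
    (tendsto_radial_integral (k - 1)).comp hA
  have hlog : Tendsto (fun ε : ℝ => -(Real.log (Q √(τ / ε)) - Real.log √(2 * Real.pi)))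
      (𝓝[>] 0) (𝓝 0) := by
    have := ((hQlim.log hs2.ne').sub_const (Real.log √(2 * Real.pi))).neg
    simpa using this
  have hO : (fun ε : ℝ => ε * -(Real.log (Q √(τ / ε)) - Real.log √(2 * Real.pi)))
      =o[𝓝[>] 0] (fun ε : ℝ => ε * 1) :=
    (isBigO_refl _ _).mul_isLittleO ((isLittleO_one_iff ℝ).2 hlog)
  simp only [mul_one] at hO
  refine hO.congr' ?_ (Eventually.of_forall fun _ => rfl)
  have hQpos : ∀ᶠ ε in 𝓝[>] (0 : ℝ), 0 < Q √(τ / ε) := hQlim.eventually_const_lt hs2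
  filter_upwards [hQpos, self_mem_nhdsWithin] with ε hQε hε
  replace hε : 0 < ε := hε
  have hA0 : 0 < √(τ / ε) := Real.sqrt_pos.2 (by positivity)
  have hAeq : ε⁻¹ * √(ε * τ) = √(τ / ε) := by
    rw [← Real.sqrt_sq (inv_pos.2 hε).le, ← Real.sqrt_mul (by positivity)]
    congr 1; field_simp
  have hJeq : J √(τ / ε) = Q √(τ / ε) * Real.exp (τ / ε / 2) * √(τ / ε) ^ (k - 1) := by
    have hsq : √(τ / ε) ^ 2 / 2 = τ / ε / 2 := by rw [Real.sq_sqrt (by positivity)]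
    simp only [hQ, hsq, Real.exp_neg]
    field_simp
  have hval : gaussMean ε⁻¹ (ε * τ) (0 : Rd k) =
      c * (Q √(τ / ε) * Real.exp (τ / ε / 2) * √(τ / ε) ^ (k - 1)) := by
    rw [gaussMean_apply_zero hk, hAeq, ← hJeq, hc]
    ring
  have hlogA : Real.log √(τ / ε) = (Real.log τ - Real.log ε) / 2 := by
    rw [Real.log_sqrt (by positivity), Real.log_div hτ.ne' hε.ne']
  rw [coleHopf, map_zero, ← hτdef, hval, negNormProj_eq h, map_zero, norm_zero,
    expansion_constant_eq, ← hc, Real.log_mul hc0.ne' (by positivity),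
    Real.log_mul (by positivity) (by positivity), Real.log_mul hQε.ne' (Real.exp_pos _).ne',
    Real.log_exp, Real.log_pow, hlogA, Real.log_mul hc0.ne' hs2.ne', Nat.cast_sub hk,
    Nat.cast_one]
  field_simp
  ring

/-! ### Sharpness of the rate and of the constant -/

/-- An expansion `D(ε) = m ε log ε + b ε + o(ε)` determines `m` as the limit of `D(ε)/(ε log ε)`. -/
theorem tendsto_div_mul_log {D : ℝ → ℝ} {m b : ℝ}
    (h : (fun ε : ℝ => D ε - (m * (ε * Real.log ε) + b * ε)) =o[𝓝[>] 0] fun ε : ℝ => ε) :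
    Tendsto (fun ε => D ε / (ε * Real.log ε)) (𝓝[>] 0) (𝓝 m) := by
  have h1 := (h.tendsto_div_nhds_zero.add_const b).mul
    (Real.tendsto_log_nhdsGT_zero.inv_tendsto_atBot)
  have h2 := h1.add_const m
  rw [mul_zero, zero_add] at h2
  refine h2.congr' ?_
  filter_upwards [Ioo_mem_nhdsGT (zero_lt_one (α := ℝ))] with ε hε
  have h3 : ε ≠ 0 := hε.1.ne'
  have h4 : Real.log ε ≠ 0 := (Real.log_neg hε.1 hε.2).ne
  simp only [Pi.inv_apply]
  field_simp
  ring

theorem eventually_mul_log_neg : ∀ᶠ ε in 𝓝[>] (0 : ℝ), ε * Real.log ε < 0 := by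
  filter_upwards [Ioo_mem_nhdsGT (zero_lt_one (α := ℝ))] with ε hε
  exact mul_neg_of_pos_of_neg hε.1 (Real.log_neg hε.1 hε.2)

theorem isBigO_mul_log_of_abs_le {D r : ℝ → ℝ} {m : ℝ} (hm : 0 < m)
    (hD : Tendsto (fun ε => D ε / (ε * Real.log ε)) (𝓝[>] 0) (𝓝 m))
    (hr : ∀ᶠ ε in 𝓝[>] (0 : ℝ), |D ε| ≤ r ε) :
    (fun ε : ℝ => ε * Real.log ε) =O[𝓝[>] 0] r := by
  refine IsBigO.of_bound (2 / m) ?_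
  filter_upwards [hr, hD.eventually_const_lt (half_lt_self hm), eventually_mul_log_neg]
    with ε h1 h2 h3
  rw [lt_div_iff_of_neg h3] at h2
  rw [Real.norm_eq_abs, Real.norm_eq_abs, abs_of_neg h3, div_mul_eq_mul_div, le_div_iff₀ hm]
  have h4 := h1.trans (le_abs_self (r ε))
  have h5 := neg_abs_le (D ε)
  linarith

theorem le_of_mul_log_sub_le {D : ℝ → ℝ} {m c C : ℝ}
    (hD : Tendsto (fun ε => D ε / (ε * Real.log ε)) (𝓝[>] 0) (𝓝 m))
    (h : ∀ᶠ ε in 𝓝[>] (0 : ℝ), c * (ε * Real.log ε) - C * ε ≤ D ε) : m ≤ c := by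
  have hlim : Tendsto (fun ε => c - C * (Real.log ε)⁻¹) (𝓝[>] 0) (𝓝 c) := by
    simpa using (Real.tendsto_log_nhdsGT_zero.inv_tendsto_atBot.const_mul C).const_sub c
  refine le_of_tendsto_of_tendsto hD hlim ?_
  filter_upwards [h, eventually_mul_log_neg, self_mem_nhdsWithin] with ε h1 h2 hε
  replace hε : 0 < ε := hε
  have h3 : Real.log ε ≠ 0 := right_ne_zero_of_mul h2.ne
  rw [div_le_iff_of_neg h2]
  calc (c - C * (Real.log ε)⁻¹) * (ε * Real.log ε) = c * (ε * Real.log ε) - C * ε := by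
        field_simp
    _ ≤ D ε := h1

/-- The expansion at the origin, for arbitrary families of solutions. -/
theorem isLittleO_viscous_sub_expansion {d k : ℕ} (hk : 1 ≤ k) (h : k ≤ d) {T : ℝ} (hT : 0 < T)
    {φ : ℝ → ℝ → Rd d → ℝ} {φ₀ : ℝ → Rd d → ℝ}
    (hφ : ∀ ε ∈ Ioc (0 : ℝ) 1,
      IsViscousHJSolution d T ε (fun _ => 0) (negNormProj d k) (φ ε))
    (hφ₀ : IsViscosityHJSolution d T (fun _ => 0) (negNormProj d k) φ₀) {t : ℝ}
    (ht : t ∈ Ico (0 : ℝ) T) :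
    (fun ε : ℝ => φ ε t 0 -
      (φ₀ t 0 + ((k : ℝ) - 1) / 2 * (ε * Real.log ε)
        - ((k : ℝ) - 1) / 2 * (ε * Real.log (T - t))
        - ε * Real.log ((k : ℝ) * √Real.pi /
            ((2 : ℝ) ^ (((k : ℝ) - 1) / 2) * Real.Gamma ((k : ℝ) / 2 + 1)))))
      =o[𝓝[>] 0] (fun ε : ℝ => ε) := by
  have ht' : t ∈ Icc 0 T := ⟨ht.1, ht.2.le⟩
  refine (isLittleO_coleHopf_zero hk h ht.2).congr' ?_ (Eventually.of_forall fun _ => rfl)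
  filter_upwards [Ioc_mem_nhdsGT (zero_lt_one (α := ℝ))] with ε hε
  rw [(hφ ε hε).unique hT hε.1 (isViscousHJSolution_coleHopf h hε.1) t ht' 0,
    hφ₀.eq_explicit hk h hT t ht' 0]

theorem mainTheorem4 (d : ℕ) (hd : 1 ≤ d) (T : ℝ) (hT : 0 < T) :
    -- for each `1 ≤ k ≤ d`: admissible datum, well-posedness, and the expansion at `x = 0`
    (∀ k : ℕ, 1 ≤ k → k ≤ d →
      LipschitzWith 1 (negNormProj d k) ∧ ConcaveOn ℝ univ (negNormProj d k) ∧
      (∀ ε ∈ Ioc (0 : ℝ) 1,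
        (∃ φ, IsViscousHJSolution d T ε (fun _ => 0) (negNormProj d k) φ) ∧
        (∀ φ ψ, IsViscousHJSolution d T ε (fun _ => 0) (negNormProj d k) φ →
          IsViscousHJSolution d T ε (fun _ => 0) (negNormProj d k) ψ →
          ∀ t ∈ Icc (0 : ℝ) T, ∀ x, φ t x = ψ t x)) ∧
      (∃ φ, IsViscosityHJSolution d T (fun _ => 0) (negNormProj d k) φ) ∧
      (∀ φ ψ, IsViscosityHJSolution d T (fun _ => 0) (negNormProj d k) φ →
        IsViscosityHJSolution d T (fun _ => 0) (negNormProj d k) ψ →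
        ∀ t ∈ Icc (0 : ℝ) T, ∀ x, φ t x = ψ t x) ∧
      (∀ (φ : ℝ → ℝ → Rd d → ℝ) (φ₀ : ℝ → Rd d → ℝ),
        (∀ ε ∈ Ioc (0 : ℝ) 1,
          IsViscousHJSolution d T ε (fun _ => 0) (negNormProj d k) (φ ε)) →
        IsViscosityHJSolution d T (fun _ => 0) (negNormProj d k) φ₀ →
        ∀ t ∈ Ico (0 : ℝ) T,
          (fun ε : ℝ => φ ε t 0 -
            (φ₀ t 0 + ((k : ℝ) - 1) / 2 * (ε * Real.log ε)
              - ((k : ℝ) - 1) / 2 * (ε * Real.log (T - t))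
              - ε * Real.log ((k : ℝ) * √Real.pi /
                  ((2 : ℝ) ^ (((k : ℝ) - 1) / 2) * Real.Gamma ((k : ℝ) / 2 + 1)))))
            =o[𝓝[>] 0] (fun ε : ℝ => ε))) ∧
    -- optimality of the rate and of the constant, with the datum `g_d(x) = -|x|`
    (∀ (φ : ℝ → ℝ → Rd d → ℝ) (φ₀ : ℝ → Rd d → ℝ),
      (∀ ε ∈ Ioc (0 : ℝ) 1,
        IsViscousHJSolution d T ε (fun _ => 0) (negNormProj d d) (φ ε)) →
      IsViscosityHJSolution d T (fun _ => 0) (negNormProj d d) φ₀ →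
      (2 ≤ d → ∀ r : ℝ → ℝ,
        (∀ᶠ ε in 𝓝[>] (0 : ℝ), ∀ t ∈ Icc (0 : ℝ) T, ∀ x, |φ ε t x - φ₀ t x| ≤ r ε) →
        (fun ε : ℝ => ε * Real.log ε) =O[𝓝[>] 0] r) ∧
      (∀ C : ℝ,
        (∀ᶠ ε in 𝓝[>] (0 : ℝ), ∀ t ∈ Icc (0 : ℝ) T, ∀ x,
          |φ ε t x - φ₀ t x| ≤ -C * (ε * Real.log ε)) →
        ((d : ℝ) - 1) / 2 ≤ C) ∧
      (∀ c C : ℝ,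
        (∀ᶠ ε in 𝓝[>] (0 : ℝ), ∀ t ∈ Icc (0 : ℝ) T, ∀ x,
          c * (ε * Real.log ε) - C * ε ≤ φ ε t x - φ₀ t x) →
        ((d : ℝ) - 1) / 2 ≤ c)) := by
  constructor
  · intro k hk h
    refine ⟨lipschitzWith_negNormProj h, concaveOn_negNormProj h, fun ε hε =>
      ⟨⟨_, isViscousHJSolution_coleHopf h hε.1⟩, fun φ ψ hφ hψ => hφ.unique hT hε.1 hψ⟩,
      ⟨_, isViscosityHJSolution_explicit hk h T⟩, fun φ ψ hφ hψ t ht x => ?_,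
      fun φ φ₀ hφ hφ₀ t ht => isLittleO_viscous_sub_expansion hk h hT hφ hφ₀ ht⟩
    rw [hφ.eq_explicit hk h hT t ht x, hψ.eq_explicit hk h hT t ht x]
  · intro φ φ₀ hφ hφ₀
    have hmem : (0 : ℝ) ∈ Icc 0 T := ⟨le_rfl, hT.le⟩
    have hD : Tendsto (fun ε => (φ ε 0 0 - φ₀ 0 0) / (ε * Real.log ε)) (𝓝[>] 0)
        (𝓝 (((d : ℝ) - 1) / 2)) := by
      refine tendsto_div_mul_log (b := -((d : ℝ) - 1) / 2 * Real.log (T - 0) -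
        Real.log ((d : ℝ) * √Real.pi /
          ((2 : ℝ) ^ (((d : ℝ) - 1) / 2) * Real.Gamma ((d : ℝ) / 2 + 1)))) ?_
      refine (isLittleO_viscous_sub_expansion hd le_rfl hT hφ hφ₀ ⟨le_rfl, hT⟩).congr_left
        fun ε => ?_
      ring
    refine ⟨fun hd2 r hr => ?_, fun C hC => ?_, fun c C hc => ?_⟩
    · have hd2' : (2 : ℝ) ≤ d := by exact_mod_cast hd2
      exact isBigO_mul_log_of_abs_le (by linarith) hD (hr.mono fun ε h => h 0 hmem 0)
    · refine le_of_mul_log_sub_le (C := 0) hD (hC.mono fun ε h => ?_)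
      have := (abs_le.1 (h 0 hmem 0)).1
      linarith
    · exact le_of_mul_log_sub_le hD (hc.mono fun ε h => h 0 hmem 0)
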